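/- Let $k$ be a commutative Noetherian ring. Let $\mathcal C$ be a $k$-linear category whose objects are parameterized by the nonnegative integers, such that every $k$-module of morphisms $\mathcal C(r,s)$ is finitely generated and $\mathcal C(r,s)=0$ whenever $r>s$. A $\mathcal C$-module is a covariant $k$-linear functor $V$ from $\mathcal C$ to $k$-modules; write $V_s=V(s)$ and $M(s)=\mathcal C(s,-)$. A $\mathcal C$-module $V$ is finitely generated if it contains a finite set of elements such that the only $\mathcal C$-submodule of $V$ containing this set is $V$; it is generated in degrees $\le d$ if the only $\mathcal C$-submodule of $V$ containing $V_r$ for all $0\le r\le d$ is $V$ (so, for $d=-1$, if $V=0$). Let $\mathfrak m=\bigoplus_{r<s}\mathcal C(r,s)$, let $H_0(V)=V/\mathfrak mV$, and let $H_i$ be the $i$-th left derived functor of $H_0$ on the category of $\mathcal C$-modules. Put $$\mathrm{hd}_i(V)=\sup\{s\ge 0 : H_i(V)_s\neq 0\}$$ ($-1$ if this set is empty), and let $\mathrm{reg}(V)=\sup\{\mathrm{hd}_i(V)-i : i\ge 0\}\in\mathbb Z\cup\{\infty\}$ be the Castelnuovo–Mumford regularity of $V$. Let $\iota:\mathcal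 C\to\mathcal C$ be a faithful $k$-linear functor with $\iota(s)=s+1$ for every $s\ge 0$, and let $S=\iota^*$ be the functor $V\mapsto V\circ\iota$ on $\mathcal C$-modules. Suppose that $S$ is a generic shift functor: there is a natural transformation $\mu:\mathrm{Id}\to S$ such that, for every $s\ge 0$, the map $\mu_{M(s)}:M(s)\to SM(s)$ is injective and its cokernel is generated in degrees $\le s-1$. If $\mathrm{reg}(SM(s))\le s$ for all $s\ge 0$, then $\mathrm{reg}(V)<\infty$ for every finitely generated $\mathcal C$-module $V$. -/

import Mathlib

open CategoryTheory CategoryTheory.Limits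

universe w v u

/-- A `k`-linear category `C` is *directed and locally finite* if its objects are parameterized by
the nonnegative integers (through `ob`), every `k`-module of morphisms `C(r, s)` is finitely
generated, and `C(r, s) = 0` whenever `r > s`. -/
class DirectedLinearCategory (k : Type u) [CommRing k] (C : Type w) [Category.{v} C]
    [Preadditive C] [Linear k C] where
  /-- The parameterization of the objects by the nonnegative integers. -/
  ob : ℕ ≃ C
  finite_hom : ∀ r s : ℕ, Module.Finite k (ob r ⟶ ob s)
  hom_eq_zero : ∀ {r s : ℕ}, s < r → ∀ f : ob r ⟶ ob s, f = 0

namespace DirectedLinearCategory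

section Modules

variable (k : Type u) [CommRing k] (C : Type w) [Category.{v} C] [Preadditive C] [Linear k C]

/-- The property of a functor from `C` to `k`-modules of being `k`-linear. -/
def isLinear : ObjectProperty (C ⥤ ModuleCat.{v} k) :=
  fun F => F.Additive ∧ F.Linear k

/-- The category of `C`-modules: covariant `k`-linear functors from `C` to `k`-modules, with the
natural transformations as morphisms. -/
abbrev CMod : Type (max w v u (v + 1)) := (isLinear k C).FullSubcategory

variable {k C}

lemma isLinear_iff (F : C ⥤ ModuleCat.{v} k) :
    isLinear k C F ↔
      (∀ {X Y : C} (f g : X ⟶ Y) (x : F.obj X), F.map (f + g) x = F.map f x + F.map g x) ∧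
      (∀ {X Y : C} (f : X ⟶ Y) (r : k) (x : F.obj X), F.map (r • f) x = r • F.map f x) := by
  constructor
  · rintro ⟨h₁, h₂⟩
    refine ⟨fun f g x => ?_, fun f r x => ?_⟩
    · rw [F.map_add]; rfl
    · rw [F.map_smul]; rfl
  · rintro ⟨h₁, h₂⟩
    refine ⟨⟨fun {X Y f g} => ?_⟩, ⟨fun f r => ?_⟩⟩
    · ext x; exact h₁ f g x
    · ext x; exact h₂ f r x

lemma map_add_apply (V : CMod k C) {X Y : C} (f g : X ⟶ Y) (x : V.obj.obj X) :
    V.obj.map (f + g) x = V.obj.map f x + V.obj.map g x :=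
  ((isLinear_iff V.obj).1 V.property).1 f g x

lemma map_smul_apply (V : CMod k C) {X Y : C} (f : X ⟶ Y) (r : k) (x : V.obj.obj X) :
    V.obj.map (r • f) x = r • V.obj.map f x :=
  ((isLinear_iff V.obj).1 V.property).2 f r x

lemma isLinear_of_jointly_injective {ι : Type*} (F : C ⥤ ModuleCat.{v} k)
    (G : ι → (C ⥤ ModuleCat.{v} k)) (hG : ∀ i, isLinear k C (G i)) (p : ∀ i, F ⟶ G i)
    (hp : ∀ (X : C) (x y : F.obj X), (∀ i, (p i).app X x = (p i).app X y) → x = y) :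
    isLinear k C F := by
  rw [isLinear_iff]
  refine ⟨fun f g x => hp _ _ _ fun i => ?_, fun f r x => hp _ _ _ fun i => ?_⟩
  · rw [map_add, NatTrans.naturality_apply, NatTrans.naturality_apply, NatTrans.naturality_apply]
    exact ((isLinear_iff _).1 (hG i)).1 _ _ _
  · rw [map_smul, NatTrans.naturality_apply, NatTrans.naturality_apply]
    exact ((isLinear_iff _).1 (hG i)).2 _ _ _

instance : (isLinear k C).IsClosedUnderSubobjects where
  prop_of_mono {F G} p _ hG := by
    refine isLinear_of_jointly_injective (ι := Unit) F (fun _ => G) (fun _ => hG) (fun _ => p) ?_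
    intro X x y h
    exact (ModuleCat.mono_iff_injective (p.app X)).1 inferInstance (h ())

instance : (isLinear k C).IsClosedUnderQuotients where
  prop_of_epi {F G} p _ hF := by
    rw [isLinear_iff] at hF ⊢
    refine ⟨fun {X Y} f g x => ?_, fun {X Y} f r x => ?_⟩
    · obtain ⟨x, rfl⟩ := (ModuleCat.epi_iff_surjective (p.app X)).1 inferInstance x
      simp only [← NatTrans.naturality_apply, hF.1, map_add]
    · obtain ⟨x, rfl⟩ := (ModuleCat.epi_iff_surjective (p.app X)).1 inferInstance x
      simp only [← NatTrans.naturality_apply, hF.2, map_smul]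

instance : (isLinear k C).IsClosedUnderFiniteProducts where
  isClosedUnderLimitsOfShape J _ := by
    refine ⟨?_⟩
    rintro F ⟨h⟩
    refine isLinear_of_jointly_injective F (fun j : Discrete J => h.diag.obj j)
      (fun j => h.prop_diag_obj j) (fun j => h.π.app j) ?_
    intro X x y hxy
    have hl := isLimitOfPreserves ((evaluation C (ModuleCat.{v} k)).obj X ⋙ forget _) h.isLimit
    exact Types.isLimitEquivSections hl |>.injective (Subtype.ext (funext fun j => hxy j))

instance : (isLinear k C).ContainsZero where
  exists_zero := by
    have h0 := initialIsInitial (C := C ⥤ ModuleCat.{v} k) |>.isZero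
    refine ⟨_, h0, isLinear_of_jointly_injective (ι := Empty) _ nofun nofun nofun ?_⟩
    intro X x y _
    have h := h0.obj X
    have := ModuleCat.subsingleton_of_isZero h
    exact Subsingleton.elim _ _

noncomputable instance : Abelian (CMod k C) := inferInstance

lemma surjective_of_epi {V W : CMod k C} (p : V ⟶ W) [Epi p] (X : C) :
    Function.Surjective (p.hom.app X) := by
  have := (isLinear k C).preservesEpimorphisms_ι_of_isNormalMonoCategory
  have : Epi p.hom := inferInstanceAs (Epi ((isLinear k C).ι.map p))
  exact (ModuleCat.epi_iff_surjective (p.hom.app X)).1 inferInstance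

lemma epi_of_surjective {V W : CMod k C} (p : V ⟶ W)
    (hp : ∀ X : C, Function.Surjective (p.hom.app X)) : Epi p := by
  have (X : C) : Epi (p.hom.app X) := (ModuleCat.epi_iff_surjective _).2 (hp X)
  have : Epi ((isLinear k C).ι.map p) := NatTrans.epi_of_epi_app p.hom
  exact (isLinear k C).ι.epi_of_epi_map this

end Modules

section Projectives

variable {k : Type u} [CommRing k] {C : Type w} [Category.{v} C] [Preadditive C] [Linear k C]

/-- The functor `⨁ i, C(o i, -)`. -/
noncomputable def freeFunctor {I : Type v} (o : I → C) : C ⥤ ModuleCat.{v} k where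
  obj X := ModuleCat.of k (Π₀ i : I, (o i ⟶ X))
  map f := ModuleCat.ofHom (DFinsupp.mapRange.linearMap fun i => Linear.rightComp k (o i) f)
  map_id X := by
    classical
    refine ModuleCat.hom_ext (DFinsupp.lhom_ext fun i g => ?_)
    simp
  map_comp f g := by
    classical
    refine ModuleCat.hom_ext (DFinsupp.lhom_ext fun i g => ?_)
    simp

/-- The direct sum of representable `C`-modules `⨁ i, C(o i, -)`. -/
noncomputable def free {I : Type v} (o : I → C) : CMod k C where
  obj := freeFunctor o
  property := by
    rw [isLinear_iff]
    refine ⟨fun f g x => ?_, fun f r x => ?_⟩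
    · refine DFinsupp.ext fun i => ?_
      exact Preadditive.comp_add _ _ _ _ _ _
    · refine DFinsupp.ext fun i => ?_
      exact Linear.comp_smul _ _ _ _ _ _

/-- The element `f` of the `i`-th summand of `⨁ i, C(o i, -)`. -/
noncomputable def freeSingle {I : Type v} (o : I → C) (i : I) {X : C} (f : o i ⟶ X) :
    (free (k := k) o).obj.obj X := by
  classical
  exact (DFinsupp.single i f : Π₀ i : I, (o i ⟶ X))

lemma free_map_freeSingle {I : Type v} (o : I → C) (i : I) {X Y : C} (f : o i ⟶ X) (g : X ⟶ Y) :
    (free (k := k) o).obj.map g (freeSingle o i f) = freeSingle o i (f ≫ g) := by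
  classical
  exact DFinsupp.mapRange_single (hf := fun i => map_zero (Linear.rightComp k (o i) g))

/-- The morphism from a direct sum of representable `C`-modules given by a family of elements. -/
noncomputable def freeLift {I : Type v} (o : I → C) (V : CMod k C) (y : ∀ i, V.obj.obj (o i)) :
    free (k := k) o ⟶ V := by
  classical
  exact ObjectProperty.homMk
    { app X := ModuleCat.ofHom (DFinsupp.lsum ℕ fun i =>
        { toFun f := V.obj.map f (y i)
          map_add' f g := map_add_apply V f g (y i)
          map_smul' r f := map_smul_apply V f r (y i) })
      naturality X Y f := by
        refine ModuleCat.hom_ext (DFinsupp.lhom_ext fun i g => ?_)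
        simp [free, freeFunctor] }

lemma freeLift_freeSingle {I : Type v} (o : I → C) (V : CMod k C)
    (y : ∀ i, V.obj.obj (o i)) {X : C} (i : I) (f : o i ⟶ X) :
    (freeLift o V y).hom.app X (freeSingle o i f) = V.obj.map f (y i) := by
  classical
  exact DFinsupp.lsum_single (R := k) ℕ (M := fun j => (o j ⟶ X)) _ i f

lemma free_hom_ext {I : Type v} (o : I → C) {V : CMod k C} {p q : free (k := k) o ⟶ V}
    (h : ∀ i, p.hom.app (o i) (freeSingle o i (𝟙 (o i))) =
      q.hom.app (o i) (freeSingle o i (𝟙 (o i)))) : p = q := by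
  classical
  refine ObjectProperty.hom_ext _ (NatTrans.ext (funext fun X => ?_))
  refine ModuleCat.hom_ext (DFinsupp.lhom_ext fun i g => ?_)
  have hp := NatTrans.naturality_apply p.hom g (freeSingle o i (𝟙 (o i)))
  have hq := NatTrans.naturality_apply q.hom g (freeSingle o i (𝟙 (o i)))
  rw [h i, ← hq, free_map_freeSingle, Category.id_comp] at hp
  exact hp

instance {I : Type v} (o : I → C) : Projective (free (k := k) o) where
  factors {E W} f e _ := by
    choose y hy using fun i => surjective_of_epi e (o i)
      (f.hom.app (o i) (freeSingle o i (𝟙 (o i))))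
    refine ⟨freeLift o E y, free_hom_ext o fun i => ?_⟩
    rw [← hy i, ObjectProperty.FullSubcategory.comp_hom, NatTrans.comp_app,
      ConcreteCategory.comp_apply, freeLift_freeSingle]
    simp

instance [DirectedLinearCategory k C] : EnoughProjectives (CMod k C) where
  presentation V := by
    let o : (Σ s : ℕ, V.obj.obj (ob k s)) → C := fun i => ob k i.1
    let p : free o ⟶ V := freeLift o V fun i => i.2
    have hp : Epi p := by
      refine epi_of_surjective p fun X x => ?_
      obtain ⟨s, rfl⟩ := (ob k (C := C)).surjective X
      refine ⟨freeSingle o ⟨s, x⟩ (𝟙 (ob k s)), ?_⟩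
      refine (freeLift_freeSingle o V (fun i => i.2) ⟨s, x⟩ (𝟙 (ob k s))).trans ?_
      rw [V.obj.map_id]
      rfl
    exact ⟨{ p := free o, f := p }⟩

end Projectives

section Homology

variable {k : Type u} [CommRing k] {C : Type w} [Category.{v} C] [Preadditive C] [Linear k C]
  [DirectedLinearCategory k C]

variable (k) in
/-- The index of an object of `C` in the parameterization by the nonnegative integers. -/
def deg (X : C) : ℕ := (ob k).symm X

/-- The value `(𝔪 V)(X)`, where `𝔪 = ⨁_{r < s} C(r, s)`: the submodule of `V(X)` spanned by the
images of the maps induced by the morphisms to `X` from objects of smaller index. -/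
def mSub (V : CMod k C) (X : C) : Submodule k (V.obj.obj X) :=
  Submodule.span k {y | ∃ (Y : C) (f : Y ⟶ X) (x : V.obj.obj Y), deg k Y < deg k X ∧
    V.obj.map f x = y}

lemma mSub_le_comap_map (V : CMod k C) {X Y : C} (g : X ⟶ Y) :
    mSub V X ≤ (mSub V Y).comap (V.obj.map g).hom := by
  unfold mSub
  refine Submodule.span_le.2 ?_
  rintro _ ⟨Z, f, x, h, rfl⟩
  by_cases hXY : deg k X ≤ deg k Y
  · exact Submodule.subset_span ⟨Z, f ≫ g, x, h.trans_le hXY, by simp⟩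
  · have hg : g = 0 := by
      obtain ⟨r, rfl⟩ := (ob k (C := C)).surjective X
      obtain ⟨s, rfl⟩ := (ob k (C := C)).surjective Y
      exact hom_eq_zero (by simpa [deg] using hXY) g
    have := V.property.1
    simp [hg]

lemma mSub_le_comap_app {V W : CMod k C} (p : V ⟶ W) (X : C) :
    mSub V X ≤ (mSub W X).comap (p.hom.app X).hom := by
  unfold mSub
  refine Submodule.span_le.2 ?_
  rintro _ ⟨Z, f, x, h, rfl⟩
  exact Submodule.subset_span ⟨Z, f, p.hom.app Z x, h, (NatTrans.naturality_apply p.hom f x).symm⟩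

/-- The functor underlying the `C`-module `V / 𝔪 V`. -/
def quotientFunctor (V : CMod k C) : C ⥤ ModuleCat.{v} k where
  obj X := ModuleCat.of k (V.obj.obj X ⧸ mSub V X)
  map f := ModuleCat.ofHom (Submodule.mapQ _ _ (V.obj.map f).hom (mSub_le_comap_map V f))
  map_id X := by
    refine ModuleCat.hom_ext (Submodule.linearMap_qext _ ?_)
    ext x; simp
  map_comp f g := by
    refine ModuleCat.hom_ext (Submodule.linearMap_qext _ ?_)
    ext x; simp

lemma quotientFunctor_map_mkQ (V : CMod k C) {X Y : C} (f : X ⟶ Y) (x : V.obj.obj X) :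
    (quotientFunctor V).map f ((mSub V X).mkQ x) = (mSub V Y).mkQ (V.obj.map f x) := rfl

/-- The `C`-module `V / 𝔪 V`. -/
def quotientM (V : CMod k C) : CMod k C where
  obj := quotientFunctor V
  property := by
    rw [isLinear_iff]
    constructor
    · intro X Y f g x
      obtain ⟨x, rfl⟩ := Submodule.mkQ_surjective _ x
      rw [quotientFunctor_map_mkQ, quotientFunctor_map_mkQ, quotientFunctor_map_mkQ,
        map_add_apply, map_add]
      rfl
    · intro X Y f r x
      obtain ⟨x, rfl⟩ := Submodule.mkQ_surjective _ x
      rw [quotientFunctor_map_mkQ, quotientFunctor_map_mkQ, map_smul_apply, _root_.map_smul]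
      rfl

variable (k C) in
/-- The `0`-th homology functor `V ↦ V / 𝔪 V`. -/
def H0 : CMod k C ⥤ CMod k C where
  obj V := quotientM V
  map {V W} p := ObjectProperty.homMk
    { app X := ModuleCat.ofHom (Submodule.mapQ _ _ (p.hom.app X).hom (mSub_le_comap_app p X))
      naturality X Y f := by
        refine ModuleCat.hom_ext (Submodule.linearMap_qext _ ?_)
        ext x
        exact congrArg (mSub W Y).mkQ (NatTrans.naturality_apply p.hom f x) }
  map_id V := by
    refine ObjectProperty.hom_ext _ (NatTrans.ext (funext fun X => ?_))
    refine ModuleCat.hom_ext (Submodule.linearMap_qext _ ?_)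
    rfl
  map_comp p q := by
    refine ObjectProperty.hom_ext _ (NatTrans.ext (funext fun X => ?_))
    refine ModuleCat.hom_ext (Submodule.linearMap_qext _ ?_)
    rfl

instance : (H0 k C).Additive where
  map_add {V W p q} := by
    refine ObjectProperty.hom_ext _ (NatTrans.ext (funext fun X => ?_))
    refine ModuleCat.hom_ext (Submodule.linearMap_qext _ ?_)
    rfl

/-- The `i`-th homology `H_i(V) = Tor_i(C/𝔪, V)`, where `H_i` is the `i`-th left derived functor
of `H_0`. -/
noncomputable def homology (i : ℕ) (V : CMod k C) : CMod k C :=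
  ((H0 k C).leftDerived i).obj V

/-- The `i`-th homological degree `sup {s | H_i(V)_s ≠ 0}`, which is `-1` if `H_i(V) = 0`
(inserting `-1` does not change the supremum of a nonempty set of natural numbers). -/
noncomputable def hd (i : ℕ) (V : CMod k C) : EReal :=
  sSup (insert (-1) {d | ∃ s : ℕ, Nontrivial ((homology i V).obj.obj (ob k s)) ∧ d = s})

/-- The Castelnuovo–Mumford regularity `sup {hd_i(V) - i | i ≥ 0}`. -/
noncomputable def reg (V : CMod k C) : EReal :=
  ⨆ i : ℕ, (hd i V - i)

variable (k C) in
/-- The `C`-module `M(s) = C(s, -)`. -/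
def M (s : ℕ) : CMod k C where
  obj := (linearCoyoneda k C).obj (Opposite.op (ob k s))
  property := by
    rw [isLinear_iff]
    exact ⟨fun f g x => Preadditive.comp_add _ _ _ _ _ _, fun f r x => Linear.comp_smul _ _ _ _ _ _⟩

end Homology

section Generation

variable {k : Type u} [CommRing k] {C : Type w} [Category.{v} C] [Preadditive C] [Linear k C]

/-- A `C`-submodule of `V`: a family of `k`-submodules stable under the action of `C`. -/
structure CSubmodule (V : CMod k C) where
  carrier : ∀ X : C, Submodule k (V.obj.obj X)
  map_mem : ∀ {X Y : C} (f : X ⟶ Y) {x : V.obj.obj X}, x ∈ carrier X → V.obj.map f x ∈ carrier Y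

/-- `V` is finitely generated: it contains a finite set of (homogeneous) elements such that the
only `C`-submodule of `V` containing this set is `V`. -/
def IsFinitelyGenerated (V : CMod k C) : Prop :=
  ∃ T : Set (Σ X : C, V.obj.obj X), T.Finite ∧
    ∀ N : CSubmodule V, (∀ t ∈ T, t.2 ∈ N.carrier t.1) → ∀ X, N.carrier X = ⊤

/-- `V` is generated in degrees `≤ d`: the only `C`-submodule of `V` that contains `V_r` for all
`r ≤ d` is `V`. For `d = -1` this means that `V = 0`. -/
def IsGeneratedInDegreesLE [DirectedLinearCategory k C] (V : CMod k C) (d : ℤ) : Prop :=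
  ∀ N : CSubmodule V, (∀ r : ℕ, (r : ℤ) ≤ d → N.carrier (ob k r) = ⊤) → ∀ X, N.carrier X = ⊤

end Generation

section Shift

variable (k : Type u) [CommRing k] (C : Type w) [Category.{v} C] [Preadditive C] [Linear k C]
  [DirectedLinearCategory k C]

/-- A self-embedding functor of degree `1`: a faithful (`k`-linear) functor `ι : C ⥤ C` with
`ι(s) = s + 1`. -/
structure SelfEmbedding where
  functor : C ⥤ C
  additive : functor.Additive
  linear : functor.Linear k
  faithful : functor.Faithful
  obj_ob : ∀ s : ℕ, functor.obj (ob k s) = ob k (s + 1)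

variable {k C}

/-- The shift functor: the pull-back functor `ι^*` of a self-embedding functor `ι` of degree `1`. -/
def SelfEmbedding.shift (ι : SelfEmbedding k C) : CMod k C ⥤ CMod k C where
  obj V :=
    { obj := ι.functor ⋙ V.obj
      property := by
        have := ι.additive
        have := ι.linear
        have := V.property.1
        have := V.property.2
        exact ⟨inferInstance, inferInstance⟩ }
  map p := ObjectProperty.homMk (Functor.whiskerLeft ι.functor p.hom)

/-- The shift functor `S` is *generic* if there is a natural transformation `μ : Id ⟶ S` such that,
for every `s`, the map `M(s) ⟶ S M(s)` is injective and its cokernel is generated in degrees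
`≤ s - 1`. -/
def SelfEmbedding.IsGeneric (ι : SelfEmbedding k C) : Prop :=
  ∃ μ : 𝟭 (CMod k C) ⟶ ι.shift, ∀ s : ℕ,
    (∀ X : C, Function.Injective ((μ.app (M k C s)).hom.app X)) ∧
      IsGeneratedInDegreesLE (cokernel (μ.app (M k C s))) ((s : ℤ) - 1)

end Shift

end DirectedLinearCategory

/-! By Yoneda, a generic shift comes from a natural transformation `e : 𝟭 C ⟶ ι.functor`, which
gives every V a map V → SV; its cokernel is the derivative DV. The proof is an induction on the
generation degree, which D lowers: DM(s) is generated in degrees < s, hence DV in degrees < n as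
soon as V is generated in degrees < n + 1 (`generatedLT_derivative`).

Regularity descends from SV to V. Cover V by a finite sum of M(s) with s in the degrees generating
V. Since reg SM(s) ≤ s, shifting the cover costs nothing, so a bound on reg SV controls the shift of
the syzygy; iterating over syzygies, reg SV < a gives reg V < a + 1 (`regLT_of_shift`). If V → SV is
injective, the snake lemma makes D exact on these sequences too, and the same argument bounds reg V
by reg DV (`regLT_of_derivative`). Both are instances of `homologyVanishing_of_transform`.

For general V, the kernels of V → SʲV form an ascending chain, which stabilizes because V is
Noetherian (`PointwiseFinite.wellFoundedGT`, in the style of Hilbert's basis theorem). Induct on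
where it stops. If it is zero, V embeds in SV and the derivative decides. Otherwise put K = ker(V →
SV) and F = V/K; the chain of F stops one step earlier. The snake lemma gives an exact sequence 0 →
ker(F → SF) → SK → DV → DF → 0 (`exists_lift_ker_derivativeMap`). The outer induction bounds DV and
DF, the inner one F and ker(F → SF). So SK has finite regularity, hence K, hence V. -/

namespace DirectedLinearCategory

/-! ### Submodules, quotients and pointwise short exact sequences. -/

section Submodules

variable {k : Type u} [CommRing k] {C : Type w} [Category.{v} C] [Preadditive C] [Linear k C]

lemma map_comp_apply (V : CMod k C) {X Y Z : C} (f : X ⟶ Y) (g : Y ⟶ Z) (x : V.obj.obj X) :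
    V.obj.map (f ≫ g) x = V.obj.map g (V.obj.map f x) := by
  simp

lemma app_comp_apply {V W U : CMod k C} (p : V ⟶ W) (q : W ⟶ U) {X : C} (x : V.obj.obj X) :
    (p ≫ q).hom.app X x = q.hom.app X (p.hom.app X x) := rfl

lemma app_map_apply {V W : CMod k C} (p : V ⟶ W) {X Y : C} (f : X ⟶ Y) (x : V.obj.obj X) :
    p.hom.app Y (V.obj.map f x) = W.obj.map f (p.hom.app X x) :=
  NatTrans.naturality_apply p.hom f x

lemma hom_ext_apply {V W : CMod k C} {p q : V ⟶ W}
    (h : ∀ (X : C) (x : V.obj.obj X), p.hom.app X x = q.hom.app X x) : p = q :=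
  ObjectProperty.hom_ext _ (NatTrans.ext (funext fun X => ModuleCat.hom_ext
    (LinearMap.ext fun x => h X x)))

namespace CSubmodule

variable {V W : CMod k C}

@[ext]
lemma ext_carrier {N₁ N₂ : CSubmodule V} (h : ∀ X, N₁.carrier X = N₂.carrier X) : N₁ = N₂ := by
  cases N₁; cases N₂
  congr
  exact funext h

instance : PartialOrder (CSubmodule V) :=
  PartialOrder.lift CSubmodule.carrier fun _ _ h => ext_carrier (congrFun h)

instance : Bot (CSubmodule V) where
  bot := ⟨fun _ => ⊥, by rintro X Y f x rfl; exact map_zero _⟩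

lemma mem_bot {X : C} {x : V.obj.obj X} : x ∈ (⊥ : CSubmodule V).carrier X ↔ x = 0 := Iff.rfl

/-- The functor underlying a `C`-submodule. -/
def subFunctor (N : CSubmodule V) : C ⥤ ModuleCat.{v} k where
  obj X := ModuleCat.of k (N.carrier X)
  map f := ModuleCat.ofHom ((V.obj.map f).hom.restrict fun _ hx => N.map_mem f hx)
  map_id X := by
    refine ModuleCat.hom_ext (LinearMap.ext fun x => Subtype.ext ?_)
    exact congrArg (fun f : V.obj.obj X ⟶ V.obj.obj X => f x.1) (V.obj.map_id X)
  map_comp f g := by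
    refine ModuleCat.hom_ext (LinearMap.ext fun x => Subtype.ext ?_)
    exact map_comp_apply V f g x.1

/-- The `C`-module underlying a `C`-submodule. -/
def toCMod (N : CSubmodule V) : CMod k C where
  obj := N.subFunctor
  property := by
    rw [isLinear_iff]
    exact ⟨fun f g x => Subtype.ext (map_add_apply V f g x.1),
      fun f r x => Subtype.ext (map_smul_apply V f r x.1)⟩

/-- The inclusion of a `C`-submodule. -/
def incl (N : CSubmodule V) : N.toCMod ⟶ V :=
  ObjectProperty.homMk
    { app X := ModuleCat.ofHom (N.carrier X).subtype
      naturality X Y f := by ext x; rfl }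

/-- The factorization of a morphism through a `C`-submodule containing its image. -/
def lift (N : CSubmodule V) (p : W ⟶ V) (h : ∀ X x, p.hom.app X x ∈ N.carrier X) :
    W ⟶ N.toCMod :=
  ObjectProperty.homMk
    { app X := ModuleCat.ofHom ((p.hom.app X).hom.codRestrict (N.carrier X) (h X))
      naturality X Y f := by
        ext x
        exact Subtype.ext (app_map_apply p f x) }

/-- The functor underlying the quotient of a `C`-module by a `C`-submodule. -/
def quotFunctor (N : CSubmodule V) : C ⥤ ModuleCat.{v} k where
  obj X := ModuleCat.of k (V.obj.obj X ⧸ N.carrier X)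
  map f := ModuleCat.ofHom (Submodule.mapQ _ _ (V.obj.map f).hom fun _ hx => N.map_mem f hx)
  map_id X := by
    refine ModuleCat.hom_ext (Submodule.linearMap_qext _ ?_)
    ext x; simp
  map_comp f g := by
    refine ModuleCat.hom_ext (Submodule.linearMap_qext _ ?_)
    ext x; simp

lemma quotFunctor_map_mkQ (N : CSubmodule V) {X Y : C} (f : X ⟶ Y) (x : V.obj.obj X) :
    N.quotFunctor.map f ((N.carrier X).mkQ x) = (N.carrier Y).mkQ (V.obj.map f x) := rfl

/-- The quotient of a `C`-module by a `C`-submodule. -/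
def quot (N : CSubmodule V) : CMod k C where
  obj := N.quotFunctor
  property := by
    rw [isLinear_iff]
    constructor
    · intro X Y f g x
      obtain ⟨x, rfl⟩ := Submodule.mkQ_surjective _ x
      rw [quotFunctor_map_mkQ, quotFunctor_map_mkQ, quotFunctor_map_mkQ, map_add_apply, map_add]
      rfl
    · intro X Y f r x
      obtain ⟨x, rfl⟩ := Submodule.mkQ_surjective _ x
      rw [quotFunctor_map_mkQ, quotFunctor_map_mkQ, map_smul_apply, _root_.map_smul]
      rfl

/-- The projection to the quotient by a `C`-submodule. -/
def proj (N : CSubmodule V) : V ⟶ N.quot :=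
  ObjectProperty.homMk
    { app X := ModuleCat.ofHom (N.carrier X).mkQ
      naturality X Y f := by ext x; rfl }

lemma proj_surjective (N : CSubmodule V) (X : C) : Function.Surjective (N.proj.hom.app X) :=
  (N.carrier X).mkQ_surjective

lemma proj_eq_zero_iff (N : CSubmodule V) {X : C} (x : V.obj.obj X) :
    N.proj.hom.app X x = 0 ↔ x ∈ N.carrier X :=
  Submodule.Quotient.mk_eq_zero (N.carrier X)

lemma proj_eq_iff (N : CSubmodule V) {X : C} (x y : V.obj.obj X) :
    N.proj.hom.app X x = N.proj.hom.app X y ↔ x - y ∈ N.carrier X :=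
  Submodule.Quotient.eq (N.carrier X)

/-- The morphism from a quotient induced by a morphism vanishing on the `C`-submodule. -/
def desc (N : CSubmodule V) (p : V ⟶ W) (h : ∀ X, ∀ x ∈ N.carrier X, p.hom.app X x = 0) :
    N.quot ⟶ W :=
  ObjectProperty.homMk
    { app X := ModuleCat.ofHom ((N.carrier X).liftQ (p.hom.app X).hom (h X))
      naturality X Y f := by
        refine ModuleCat.hom_ext (Submodule.linearMap_qext _ ?_)
        ext x
        exact app_map_apply p f x }

/-- The kernel of a morphism, as a `C`-submodule. -/
def ker (p : V ⟶ W) : CSubmodule V where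
  carrier X := LinearMap.ker (p.hom.app X).hom
  map_mem {X Y} f {x} hx := by
    have hx : p.hom.app X x = 0 := hx
    exact (app_map_apply p f x).trans (by rw [hx, map_zero])

lemma mem_ker {p : V ⟶ W} {X : C} {x : V.obj.obj X} :
    x ∈ (ker p).carrier X ↔ p.hom.app X x = 0 := Iff.rfl

/-- The image of a morphism, as a `C`-submodule. -/
def range (p : V ⟶ W) : CSubmodule W where
  carrier X := LinearMap.range (p.hom.app X).hom
  map_mem {X Y} f {x} hx := by
    obtain ⟨y, rfl⟩ := hx
    exact ⟨V.obj.map f y, app_map_apply p f y⟩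

/-- The inverse image of a `C`-submodule. -/
def comap (p : V ⟶ W) (N : CSubmodule W) : CSubmodule V where
  carrier X := (N.carrier X).comap (p.hom.app X).hom
  map_mem {X Y} f {x} hx := by
    have := N.map_mem f hx
    rw [Submodule.mem_comap]
    exact (app_map_apply p f x).symm ▸ this

lemma mem_comap {p : V ⟶ W} {N : CSubmodule W} {X : C} {x : V.obj.obj X} :
    x ∈ (comap p N).carrier X ↔ p.hom.app X x ∈ N.carrier X := Iff.rfl

end CSubmodule

/-- A pair of composable morphisms of `C`-modules is a short exact sequence. -/
structure IsSES {U V W : CMod k C} (f : U ⟶ V) (g : V ⟶ W) : Prop where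
  inj : ∀ X, Function.Injective (f.hom.app X)
  exact : ∀ X, Function.Exact (f.hom.app X) (g.hom.app X)
  surj : ∀ X, Function.Surjective (g.hom.app X)

lemma IsSES.of_quot {V : CMod k C} (N : CSubmodule V) : IsSES N.incl N.proj where
  inj _ := Subtype.val_injective
  exact X x := by
    rw [N.proj_eq_zero_iff]
    exact ⟨fun h => ⟨⟨x, h⟩, rfl⟩, by rintro ⟨y, rfl⟩; exact y.2⟩
  surj := N.proj_surjective

lemma IsSES.of_ker {V W : CMod k C} (p : V ⟶ W) (hp : ∀ X, Function.Surjective (p.hom.app X)) :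
    IsSES (CSubmodule.ker p).incl p where
  inj _ := Subtype.val_injective
  exact X x := ⟨fun h => ⟨⟨x, h⟩, rfl⟩, by rintro ⟨y, rfl⟩; exact y.2⟩
  surj := hp

lemma IsSES.apply_apply {U V W : CMod k C} {f : U ⟶ V} {g : V ⟶ W} (h : IsSES f g) {X : C}
    (x : U.obj.obj X) : g.hom.app X (f.hom.app X x) = 0 :=
  (h.exact X).apply_apply_eq_zero x

lemma exists_lift_of_injective {U V W : CMod k C} (f : U ⟶ V)
    (hf : ∀ X, Function.Injective (f.hom.app X)) (p : W ⟶ V)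
    (h : ∀ X x, ∃ y, f.hom.app X y = p.hom.app X x) :
    ∃ l : W ⟶ U, ∀ X x, f.hom.app X (l.hom.app X x) = p.hom.app X x := by
  choose r hr using h
  refine ⟨ObjectProperty.homMk
    { app X := ModuleCat.ofHom
        { toFun := r X
          map_add' x y := hf X (by rw [hr, map_add, map_add, hr, hr])
          map_smul' c x := hf X (by
            rw [hr, RingHom.id_apply, _root_.map_smul, _root_.map_smul, hr]) }
      naturality X Y φ := by
        ext x
        refine hf Y ((hr Y _).trans ((app_map_apply p φ x).trans ?_))
        rw [← hr]
        exact (app_map_apply f φ (r X x)).symm }, hr⟩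

/-- For morphisms `q : Q ⟶ V` and `g : V ⟶ W`, both surjective, and `f` the kernel of `g`,
the kernel of `q ≫ g` is an extension of the kernel of `g` by the kernel of `q`. -/
lemma IsSES.exists_ker_comp {U V W Q : CMod k C} {f : U ⟶ V} {g : V ⟶ W} (h : IsSES f g)
    (q : Q ⟶ V) (hq : ∀ X, Function.Surjective (q.hom.app X)) :
    ∃ (a : (CSubmodule.ker q).toCMod ⟶ (CSubmodule.ker (q ≫ g)).toCMod)
      (b : (CSubmodule.ker (q ≫ g)).toCMod ⟶ U), IsSES a b := by
  obtain ⟨b, hb⟩ := exists_lift_of_injective f h.inj ((CSubmodule.ker (q ≫ g)).incl ≫ q)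
    fun X x => (h.exact X _).1 x.2
  refine ⟨CSubmodule.lift _ (CSubmodule.ker q).incl fun X x => ?_, b,
    fun X x y hxy => Subtype.ext (Subtype.ext_iff.1 hxy :), fun X x => ⟨fun hx => ?_, ?_⟩,
    fun X y => ?_⟩
  · exact (congrArg (g.hom.app X) (CSubmodule.mem_ker.1 x.2)).trans (map_zero _)
  · refine ⟨⟨x.1, (hb X x).symm.trans ?_⟩, rfl⟩
    rw [hx, map_zero]
  · rintro ⟨y, rfl⟩
    refine h.inj X ((hb X _).trans ?_)
    rw [map_zero]
    exact y.2
  · obtain ⟨x, hx⟩ := hq X (f.hom.app X y)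
    refine ⟨⟨x, ?_⟩, h.inj X ((hb X _).trans hx)⟩
    rw [CSubmodule.mem_ker, app_comp_apply, hx, h.apply_apply]

end Submodules

/-! ### Testing exactness and homology on elements. -/

section Exactness

variable {k : Type u} [CommRing k] {C : Type w} [Category.{v} C] [Preadditive C] [Linear k C]

variable (k) in
/-- The evaluation of `C`-modules at an object. -/
abbrev evalAt (X : C) : CMod k C ⥤ ModuleCat.{v} k :=
  (isLinear k C).ι ⋙ (evaluation C (ModuleCat.{v} k)).obj X

instance (X : C) : (evalAt k X).PreservesHomology where
  preservesKernels _ _ f := by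
    have := (isLinear k C).preservesKernels_ι f
    exact comp_preservesLimit _ _
  preservesCokernels _ _ f := by
    have := (isLinear k C).preservesCokernels_ι f
    exact comp_preservesColimit _ _

/-- Evaluation at an object preserves kernels and cokernels, so homology at X is computed in
`ModuleCat`. -/
lemma subsingleton_homology_iff (S : ShortComplex (CMod k C)) (X : C) :
    Subsingleton (S.homology.obj.obj X) ↔
      ∀ x, S.g.hom.app X x = 0 → ∃ y, S.f.hom.app X y = x := by
  rw [← ModuleCat.isZero_iff_subsingleton]
  refine (Iso.isZero_iff (S.mapHomologyIso (evalAt k X)).symm).trans ?_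
  rw [← ShortComplex.exact_iff_isZero_homology, ShortComplex.moduleCat_exact_iff]
  rfl

lemma exact_iff_apply (S : ShortComplex (CMod k C)) :
    S.Exact ↔ ∀ X x, S.g.hom.app X x = 0 → ∃ y, S.f.hom.app X y = x := by
  simp_rw [← subsingleton_homology_iff]
  rw [ShortComplex.exact_iff_isZero_homology, IsZero.iff_id_eq_zero]
  refine ⟨fun h X => ⟨fun x y => ?_⟩, fun h => hom_ext_apply fun X x => (h X).elim _ _⟩
  have hx (x : S.homology.obj.obj X) : x = 0 :=
    congrArg (fun p : S.homology ⟶ S.homology => p.hom.app X x) h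
  rw [hx x, hx y]

end Exactness

/-! ### Dimension shifting for the derived functors of H₀. -/

section Resolutions

variable {k : Type u} [CommRing k] {C : Type w} [Category.{v} C] [Preadditive C] [Linear k C]

lemma subsingleton_iff_of_iso {V W : CMod k C} (i : V ≅ W) (X : C) :
    Subsingleton (V.obj.obj X) ↔ Subsingleton (W.obj.obj X) := by
  rw [← ModuleCat.isZero_iff_subsingleton, ← ModuleCat.isZero_iff_subsingleton]
  exact ((evalAt k X).mapIso i).isZero_iff

lemma IsSES.comp_eq_zero {U V W : CMod k C} {f : U ⟶ V} {g : V ⟶ W} (h : IsSES f g) :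
    f ≫ g = 0 :=
  hom_ext_apply fun _ x => h.apply_apply x

/-- The augmentation of a projective resolution. -/
noncomputable def resolutionAug {V : CMod k C} (P : ProjectiveResolution V) :
    P.complex.X 0 ⟶ V :=
  P.π.f 0

lemma d_comp_resolutionAug {V : CMod k C} (P : ProjectiveResolution V) :
    P.complex.d 1 0 ≫ resolutionAug P = 0 :=
  P.complex_d_comp_π_f_zero

lemma resolutionAug_surjective {V : CMod k C} (P : ProjectiveResolution V) (X : C) :
    Function.Surjective ((resolutionAug P).hom.app X) :=
  surjective_of_epi (P.π.f 0) X

lemma resolutionAug_exact {V : CMod k C} (P : ProjectiveResolution V) (X : C) :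
    Function.Exact ((P.complex.d 1 0).hom.app X) ((resolutionAug P).hom.app X) := by
  intro x
  refine ⟨(exact_iff_apply _).1 P.exact₀ X x, ?_⟩
  rintro ⟨y, rfl⟩
  rw [← app_comp_apply, d_comp_resolutionAug]
  rfl

lemma d_comp_resolutionAug_comp {V W : CMod k C} (P : ProjectiveResolution V) (f : V ⟶ W) :
    P.complex.d 1 0 ≫ resolutionAug P ≫ f = 0 := by
  rw [← Category.assoc, d_comp_resolutionAug, zero_comp]

/-- Splicing of a short exact sequence `0 ⟶ W ⟶ Q ⟶ V ⟶ 0`, with `Q` projective, and a projective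
resolution of `W`. -/
noncomputable def IsSES.splice {V W Q : CMod k C} {f : W ⟶ Q} {g : Q ⟶ V} (h : IsSES f g)
    [Projective Q] (P : ProjectiveResolution W) : ProjectiveResolution V where
  complex := P.complex.augment (resolutionAug P ≫ f) (d_comp_resolutionAug_comp P f)
  projective := by
    rintro (_ | n)
    · assumption
    · exact P.projective n
  π := (ChainComplex.toSingle₀Equiv _ _).symm ⟨g, by
      change (resolutionAug P ≫ f) ≫ g = 0
      rw [Category.assoc, h.comp_eq_zero, comp_zero]⟩
  quasiIso := by
    have : Epi g := epi_of_surjective g h.surj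
    have ex0 : (ShortComplex.mk (resolutionAug P ≫ f) g (by
        rw [Category.assoc, h.comp_eq_zero, comp_zero])).Exact := by
      rw [exact_iff_apply]
      intro X x hx
      obtain ⟨y, rfl⟩ := (h.exact X x).1 hx
      obtain ⟨z, rfl⟩ := resolutionAug_surjective P X y
      exact ⟨z, rfl⟩
    have ex1 : (ShortComplex.mk (P.complex.d 1 0) (resolutionAug P ≫ f)
        (d_comp_resolutionAug_comp P f)).Exact := by
      rw [exact_iff_apply]
      intro X x hx
      exact (resolutionAug_exact P X x).1 (h.inj X (hx.trans (map_zero _).symm))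
    refine ⟨fun n => ?_⟩
    cases n with
    | zero =>
      -- In degree 0 a quasi-isomorphism amounts to exactness at Q together with surjectivity of
      -- `g`.
      rw [ChainComplex.quasiIsoAt₀_iff, ShortComplex.quasiIso_iff_of_zeros']
      · refine (ShortComplex.exact_and_epi_g_iff_of_iso ?_).2 ⟨ex0, this⟩
        refine ShortComplex.isoMk (Iso.refl _) (Iso.refl _) (Iso.refl _) ?_ ?_
        · exact (Category.id_comp _).trans (Category.comp_id _).symm
        · refine (Category.id_comp _).trans (Eq.trans ?_ (Category.comp_id _).symm)
          exact (ChainComplex.toSingle₀Equiv_symm_apply_f_zero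
            (C := P.complex.augment (resolutionAug P ≫ f) (d_comp_resolutionAug_comp P f)) g _).symm
      all_goals rfl
    | succ n =>
      rw [quasiIsoAt_iff_exactAt']
      · rw [HomologicalComplex.exactAt_iff' _ (n + 2) (n + 1) n (by simp) (by simp)]
        cases n with
        | zero => exact ex1
        | succ n => exact P.exact_succ n
      · apply ChainComplex.exactAt_succ_single_obj

variable [DirectedLinearCategory k C]

lemma subsingleton_homology_succ_iff {V : CMod k C} (P : ProjectiveResolution V) (n : ℕ) (X : C) :
    Subsingleton ((homology (n + 1) V).obj.obj X) ↔
      ∀ x, ((H0 k C).map (P.complex.d (n + 1) n)).hom.app X x = 0 →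
        ∃ y, ((H0 k C).map (P.complex.d (n + 2) (n + 1))).hom.app X y = x := by
  refine (subsingleton_iff_of_iso (P.isoLeftDerivedObj (H0 k C) (n + 1) ≪≫
    ShortComplex.homologyMapIso (HomologicalComplex.isoSc' _ (n + 2) (n + 1) n
      (by simp) (by simp))) X).trans ?_
  exact subsingleton_homology_iff _ _

lemma subsingleton_homology_zero_iff_surjective {V : CMod k C} (P : ProjectiveResolution V)
    (X : C) :
    Subsingleton ((homology 0 V).obj.obj X) ↔
      Function.Surjective (((H0 k C).map (P.complex.d 1 0)).hom.app X) := by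
  refine (subsingleton_iff_of_iso (P.isoLeftDerivedObj (H0 k C) 0 ≪≫
    ShortComplex.homologyMapIso (HomologicalComplex.isoSc' _ 1 0 0 (by simp) (by simp))) X).trans ?_
  refine (subsingleton_homology_iff _ _).trans ?_
  refine forall_congr' fun x => ⟨fun h => h ?_, fun h _ => h⟩
  -- At the end of the complex every element is a cycle: the outgoing differential is the one from 0
  -- to 0, which is zero.
  have : (((H0 k C).mapHomologicalComplex (ComplexShape.down ℕ)).obj P.complex).d 0 0 = 0 :=
    HomologicalComplex.shape _ _ _ (by simp)
  exact congrArg (fun p : ((H0 k C).obj (P.complex.X 0) ⟶ (H0 k C).obj (P.complex.X 0)) =>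
    p.hom.app X x) this

lemma mSub_le_map {V W : CMod k C} (g : V ⟶ W) (hg : ∀ X, Function.Surjective (g.hom.app X))
    (X : C) : mSub W X ≤ (mSub V X).map (g.hom.app X).hom := by
  refine Submodule.span_le.2 ?_
  rintro _ ⟨Y, φ, x, h, rfl⟩
  obtain ⟨x, rfl⟩ := hg Y x
  exact ⟨V.obj.map φ x, Submodule.subset_span ⟨Y, φ, x, h, rfl⟩, app_map_apply g φ x⟩

lemma H0_map_apply {V W : CMod k C} (g : V ⟶ W) {X : C} (x : V.obj.obj X) :
    ((H0 k C).map g).hom.app X ((mSub V X).mkQ x) = (mSub W X).mkQ (g.hom.app X x) := rfl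

lemma H0_map_surjective {V W : CMod k C} (g : V ⟶ W) {X : C}
    (hg : Function.Surjective (g.hom.app X)) :
    Function.Surjective (((H0 k C).map g).hom.app X) := by
  intro y
  obtain ⟨y, rfl⟩ := (mSub W X).mkQ_surjective y
  obtain ⟨x, rfl⟩ := hg y
  exact ⟨(mSub V X).mkQ x, H0_map_apply g x⟩

/-- A surjection carries 𝔪V onto 𝔪W, so an element of V mapping into 𝔪W can be corrected by 𝔪V until
it lies in the kernel. Right exactness is what identifies H₀ with V/𝔪V and H₁ with a kernel. -/
lemma H0_map_exact {U V W : CMod k C} (f : U ⟶ V) (g : V ⟶ W)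
    (hg : ∀ X, Function.Surjective (g.hom.app X))
    (h : ∀ X, Function.Exact (f.hom.app X) (g.hom.app X)) (X : C) :
    Function.Exact (((H0 k C).map f).hom.app X) (((H0 k C).map g).hom.app X) := by
  intro x
  obtain ⟨x, rfl⟩ := (mSub V X).mkQ_surjective x
  constructor
  · intro hx
    obtain ⟨y, hy, hyx⟩ := mSub_le_map g hg X ((Submodule.Quotient.mk_eq_zero _).1 hx)
    obtain ⟨z, hz⟩ := (h X (x - y)).1 (by
      rw [map_sub]
      exact sub_eq_zero.2 hyx.symm)
    refine ⟨(mSub U X).mkQ z, (H0_map_apply f z).trans ?_⟩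
    rw [hz]
    refine (Submodule.Quotient.eq _).2 ?_
    rwa [sub_sub_cancel_left, neg_mem_iff]
  · rintro ⟨y, hy⟩
    obtain ⟨y, rfl⟩ := (mSub U X).mkQ_surjective y
    rw [← hy]
    refine (congrArg (mSub W X).mkQ ((h X).apply_apply_eq_zero y)).trans (map_zero _)

lemma subsingleton_homology_zero_iff (V : CMod k C) (X : C) :
    Subsingleton ((homology 0 V).obj.obj X) ↔ mSub V X = ⊤ := by
  let P := projectiveResolution V
  rw [subsingleton_homology_zero_iff_surjective P, ← Submodule.Quotient.subsingleton_iff]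
  have hs := resolutionAug_surjective P
  have hex := H0_map_exact _ _ hs (resolutionAug_exact P) X
  constructor
  · refine fun h => ⟨fun x y => ?_⟩
    have key (x : ((H0 k C).obj V).obj.obj X) : x = 0 := by
      obtain ⟨x, rfl⟩ := H0_map_surjective (resolutionAug P) (hs X) x
      exact (hex x).2 (h x)
    exact (key x).trans (key y).symm
  · exact fun h x => (hex x).1 (h.elim _ _)

lemma IsSES.subsingleton_homology_add_two_iff {V W Q : CMod k C} {f : W ⟶ Q} {g : Q ⟶ V}
    (h : IsSES f g) [Projective Q] (n : ℕ) (X : C) :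
    Subsingleton ((homology (n + 2) V).obj.obj X) ↔
      Subsingleton ((homology (n + 1) W).obj.obj X) := by
  let P := projectiveResolution W
  rw [subsingleton_homology_succ_iff P]
  exact subsingleton_homology_succ_iff (h.splice P) _ _

/-- In the spliced resolution, H₁(V) is the kernel of H₀(W) → H₀(Q); this replaces the low end of a
long exact sequence. -/
lemma IsSES.subsingleton_homology_one_iff {V W Q : CMod k C} {f : W ⟶ Q} {g : Q ⟶ V}
    (h : IsSES f g) [Projective Q] (X : C) :
    Subsingleton ((homology 1 V).obj.obj X) ↔
      ∀ x, ((H0 k C).map f).hom.app X x = 0 → x = 0 := by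
  let P := projectiveResolution W
  have hs := resolutionAug_surjective P
  have hex := H0_map_exact _ _ hs (resolutionAug_exact P) X
  refine (subsingleton_homology_succ_iff (h.splice P) 0 X).trans ?_
  change (∀ x, ((H0 k C).map (resolutionAug P ≫ f)).hom.app X x = 0 →
    ∃ y, ((H0 k C).map (P.complex.d 1 0)).hom.app X y = x) ↔ _
  rw [Functor.map_comp]
  constructor
  · intro H x hx
    obtain ⟨x, rfl⟩ := H0_map_surjective (resolutionAug P) (hs X) x
    exact (hex x).2 (H x hx)
  · exact fun H x hx => (hex x).1 (H _ hx)

lemma subsingleton_homology_succ_of_projective (V : CMod k C) [Projective V] (n : ℕ) (X : C) :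
    Subsingleton ((homology (n + 1) V).obj.obj X) :=
  ModuleCat.subsingleton_of_isZero <| (evalAt k X).map_isZero <|
    (H0 k C).isZero_leftDerived_obj_projective_succ n V

end Resolutions

/-! ### Generation degrees and regularity estimates in short exact sequences. -/

section Regularity

variable {k : Type u} [CommRing k] {C : Type w} [Category.{v} C] [Preadditive C] [Linear k C]
  [DirectedLinearCategory k C]

@[simp]
lemma deg_ob (s : ℕ) : deg k (ob k s : C) = s := (ob k).symm_apply_apply s

/-- A `C`-module is generated in degrees `< n`. -/
def GeneratedLT (n : ℕ) (V : CMod k C) : Prop :=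
  ∀ X : C, n ≤ deg k X → mSub V X = ⊤

/-- The homology of `V` vanishes in homological degrees `i ≤ n` and degrees `≥ a + i`. -/
def HomologyVanishing (n a : ℕ) (V : CMod k C) : Prop :=
  ∀ i ≤ n, ∀ X : C, a + i ≤ deg k X → Subsingleton ((homology i V).obj.obj X)

lemma GeneratedLT.mono {m n : ℕ} {V : CMod k C} (h : GeneratedLT m V) (hmn : m ≤ n) :
    GeneratedLT n V := fun X hX => h X (hmn.trans hX)

lemma HomologyVanishing.mono {m n a b : ℕ} {V : CMod k C} (h : HomologyVanishing n a V)
    (hmn : m ≤ n) (hab : a ≤ b) : HomologyVanishing m b V :=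
  fun i hi X hX => h i (hi.trans hmn) X (by lia)

lemma homologyVanishing_zero_iff {a : ℕ} {V : CMod k C} :
    HomologyVanishing 0 a V ↔ GeneratedLT a V := by
  refine ⟨fun h X hX => (subsingleton_homology_zero_iff V X).1 (h 0 le_rfl X hX), ?_⟩
  rintro h i hi X hX
  obtain rfl : i = 0 := by lia
  exact (subsingleton_homology_zero_iff V X).2 (h X hX)

lemma HomologyVanishing.generatedLT {n a : ℕ} {V : CMod k C} (h : HomologyVanishing n a V) :
    GeneratedLT a V :=
  homologyVanishing_zero_iff.1 (h.mono n.zero_le le_rfl)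

/-- Graded Nakayama: from degree n on, everything comes from strictly smaller degrees, so strong
induction on the degree applies. -/
lemma GeneratedLT.eq_top {n : ℕ} {V : CMod k C} (h : GeneratedLT n V) (N : CSubmodule V)
    (hN : ∀ X : C, deg k X < n → N.carrier X = ⊤) (X : C) : N.carrier X = ⊤ := by
  induction hd : deg k X using Nat.strong_induction_on generalizing X with
  | _ d ih =>
    subst hd
    by_cases hX : deg k X < n
    · exact hN X hX
    · rw [eq_top_iff, ← h X (not_lt.1 hX)]
      refine Submodule.span_le.2 ?_
      rintro _ ⟨Y, f, x, hYX, rfl⟩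
      refine N.map_mem f ?_
      rw [ih _ hYX Y rfl]
      trivial

lemma generatedLT_of_forall_eq_top {n : ℕ} {V : CMod k C}
    (h : ∀ N : CSubmodule V, (∀ X : C, deg k X < n → N.carrier X = ⊤) → ∀ X, N.carrier X = ⊤) :
    GeneratedLT n V := by
  classical
  intro X hX
  -- The test submodule is everything below degree n and only 𝔪V from degree n on.
  let N : CSubmodule V :=
    { carrier X := if deg k X < n then ⊤ else mSub V X
      map_mem {X Y} f x hx := by
        by_cases hY : deg k Y < n
        · simp [hY]
        · rw [if_neg hY]
          by_cases hX : deg k X < n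
          · exact Submodule.subset_span ⟨X, f, x, by lia, rfl⟩
          · rw [if_neg hX] at hx
            exact mSub_le_comap_map V f hx }
  have := h N (fun X hX => if_pos hX) X
  rwa [show N.carrier X = mSub V X from if_neg (not_lt.2 hX)] at this

lemma GeneratedLT.of_surjective {n : ℕ} {V W : CMod k C} (h : GeneratedLT n V) (p : V ⟶ W)
    (hp : ∀ X, Function.Surjective (p.hom.app X)) : GeneratedLT n W := by
  intro X hX
  rw [eq_top_iff]
  intro y _
  obtain ⟨x, rfl⟩ := hp X y
  refine mSub_le_comap_app p X ?_
  rw [h X hX]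
  trivial

lemma generatedLT_zero_iff {V : CMod k C} :
    GeneratedLT 0 V ↔ ∀ X, Subsingleton (V.obj.obj X) := by
  constructor
  · intro h X
    have := h.eq_top ⊥ (fun X hX => absurd hX (Nat.not_lt_zero _)) X
    exact ⟨fun x y => by
      have hx (x : V.obj.obj X) : x = 0 := by
        rw [← CSubmodule.mem_bot, this]
        trivial
      rw [hx x, hx y]⟩
  · intro h X _
    have := h X
    exact Subsingleton.elim _ _

lemma generatedLT_free {I : Type v} (o : I → C) (n : ℕ) (h : ∀ i, deg k (o i) < n) :
    GeneratedLT n (free (k := k) o) := by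
  classical
  intro X hX
  rw [eq_top_iff]
  rintro x -
  induction x using DFinsupp.induction with
  | h0 => exact zero_mem _
  | ha i f x _ _ ih =>
    refine add_mem (Submodule.subset_span ⟨o i, f, freeSingle o i (𝟙 _), (h i).trans_le hX, ?_⟩) ih
    rw [free_map_freeSingle, Category.id_comp]
    rfl

lemma GeneratedLT.exists_projective {n : ℕ} {V : CMod k C} (h : GeneratedLT n V) :
    ∃ (Q : CMod k C) (q : Q ⟶ V), Projective Q ∧ GeneratedLT n Q ∧
      ∀ X, Function.Surjective (q.hom.app X) := by
  let o : (Σ s : Fin n, V.obj.obj (ob k s.1)) → C := fun i => ob k i.1.1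
  refine ⟨free o, freeLift o V fun i => i.2, inferInstance, generatedLT_free o n fun i => ?_, ?_⟩
  · simp [o]
  · intro X
    refine LinearMap.range_eq_top.1 (h.eq_top (CSubmodule.range (freeLift o V fun i => i.2)) ?_ X)
    intro Y hY
    obtain ⟨s, rfl⟩ := (ob k (C := C)).surjective Y
    rw [deg_ob] at hY
    rw [eq_top_iff]
    rintro x -
    refine ⟨freeSingle o ⟨⟨s, hY⟩, x⟩ (𝟙 (ob k s)), ?_⟩
    refine (freeLift_freeSingle o V (fun i => i.2) ⟨⟨s, hY⟩, x⟩ (𝟙 (ob k s))).trans ?_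
    rw [V.obj.map_id]
    rfl

lemma HomologyVanishing.of_projective {V : CMod k C} [Projective V] {a : ℕ}
    (h : GeneratedLT a V) (n : ℕ) : HomologyVanishing n a V := by
  intro i _ X hX
  cases i with
  | zero => exact (subsingleton_homology_zero_iff V X).2 (h X hX)
  | succ i => exact subsingleton_homology_succ_of_projective V i X

/-- Dimension shifting: Hᵢ(U) is Hᵢ₊₁(W) for i > 0, while H₀(U) embeds in H₀(V) wherever H₁(W)
vanishes. The homological index drops by one, so the degree bound grows by one. -/
lemma IsSES.homologyVanishing_left {U V W : CMod k C} {f : U ⟶ V} {g : V ⟶ W} (h : IsSES f g)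
    [Projective V] {n a : ℕ} (hV : GeneratedLT (a + 1) V) (hW : HomologyVanishing (n + 1) a W) :
    HomologyVanishing n (a + 1) U := by
  intro i hi X hX
  cases i with
  | zero =>
    have hi := (h.subsingleton_homology_one_iff X).1 (hW 1 (by lia) X hX)
    have hs : Subsingleton (V.obj.obj X ⧸ mSub V X) :=
      Submodule.Quotient.subsingleton_iff.2 (hV X hX)
    rw [subsingleton_homology_zero_iff, ← Submodule.Quotient.subsingleton_iff]
    refine ⟨fun x y => ?_⟩
    exact (hi x (hs.elim _ _)).trans (hi y (hs.elim _ _)).symm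
  | succ i =>
    exact (h.subsingleton_homology_add_two_iff i X).1 (hW (i + 2) (by lia) X (by lia))

lemma IsSES.homologyVanishing_right_of_projective {U V W : CMod k C} {f : U ⟶ V} {g : V ⟶ W}
    (h : IsSES f g) [Projective V] {n a : ℕ} (hW : GeneratedLT a W)
    (hU : HomologyVanishing n (a + 1) U) : HomologyVanishing (n + 1) a W := by
  intro i hi X hX
  match i with
  | 0 => exact (subsingleton_homology_zero_iff W X).2 (hW X hX)
  | 1 =>
    have : Subsingleton (U.obj.obj X ⧸ mSub U X) := Submodule.Quotient.subsingleton_iff.2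
      ((subsingleton_homology_zero_iff U X).1 (hU 0 (by lia) X hX))
    exact (h.subsingleton_homology_one_iff X).2 fun x _ => this.elim _ _
  | i + 2 =>
    exact (h.subsingleton_homology_add_two_iff i X).2 (hU (i + 1) (by lia) X (by lia))

lemma IsSES.generatedLT_middle {U V W : CMod k C} {f : U ⟶ V} {g : V ⟶ W} (h : IsSES f g)
    {n : ℕ} (hU : GeneratedLT n U) (hW : GeneratedLT n W) : GeneratedLT n V := by
  intro X hX
  rw [eq_top_iff]
  intro x _
  obtain ⟨y, hy, hyx⟩ := mSub_le_map g h.surj X (x := g.hom.app X x) (by rw [hW X hX]; trivial)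
  obtain ⟨z, hz⟩ := (h.exact X (x - y)).1 (by
    rw [map_sub]
    exact sub_eq_zero.2 hyx.symm)
  rw [← sub_add_cancel x y, ← hz]
  refine add_mem (mSub_le_comap_app f X ?_) hy
  rw [hU X hX]
  trivial

/-- These are the estimates a long exact sequence would give, obtained by dimension shifting alone.
Cover V by a projective Q and let Z, Y be the kernels of Q → V and Q → W. Then 0 → Z → Y → U → 0 is
exact, and a statement about (U, V, W) becomes one about (Z, Y, U). The roles rotate, which is why
the three estimates are proved together. -/
theorem homologyVanishing_middle_and_left (n : ℕ) :
    (∀ (a : ℕ) {U V W : CMod k C} {f : U ⟶ V} {g : V ⟶ W}, IsSES f g →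
      HomologyVanishing n a U → HomologyVanishing n a W → HomologyVanishing n a V) ∧
    (∀ (a : ℕ) {U V W : CMod k C} {f : U ⟶ V} {g : V ⟶ W}, IsSES f g →
      HomologyVanishing n (a + 1) V → HomologyVanishing (n + 1) a W →
        HomologyVanishing n (a + 1) U) ∧
    (∀ (a : ℕ) {U V W : CMod k C} {f : U ⟶ V} {g : V ⟶ W}, IsSES f g →
      HomologyVanishing n (a + 1) U → HomologyVanishing (n + 1) a V →
        HomologyVanishing (n + 1) a W) := by
  -- At each level, the estimate for W follows from the middle estimate applied to Y, the syzygy of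
  -- W.
  have right (n : ℕ)
      (middle : ∀ (a : ℕ) {U V W : CMod k C} {f : U ⟶ V} {g : V ⟶ W}, IsSES f g →
        HomologyVanishing n a U → HomologyVanishing n a W → HomologyVanishing n a V)
      (a : ℕ) {U V W : CMod k C} {f : U ⟶ V} {g : V ⟶ W} (h : IsSES f g)
      (hU : HomologyVanishing n (a + 1) U) (hV : HomologyVanishing (n + 1) a V) :
      HomologyVanishing (n + 1) a W := by
    obtain ⟨Q, q, _, hQ, hq⟩ := hV.generatedLT.exists_projective
    obtain ⟨b, c, hbc⟩ := h.exists_ker_comp q hq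
    refine (IsSES.of_ker (q ≫ g) fun X => (h.surj X).comp (hq X))
      |>.homologyVanishing_right_of_projective (hV.generatedLT.of_surjective g h.surj) ?_
    exact middle _ hbc ((IsSES.of_ker q hq).homologyVanishing_left (hQ.mono a.le_succ) hV) hU
  induction n with
  | zero =>
    have middle (a : ℕ) {U V W : CMod k C} {f : U ⟶ V} {g : V ⟶ W} (h : IsSES f g)
        (hU : HomologyVanishing 0 a U) (hW : HomologyVanishing 0 a W) :
        HomologyVanishing 0 a V :=
      homologyVanishing_zero_iff.2 (h.generatedLT_middle hU.generatedLT hW.generatedLT)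
    refine ⟨middle, ?_, right 0 middle⟩
    intro a U V W f g h hV hW
    obtain ⟨Q, q, _, hQ, hq⟩ := hV.generatedLT.exists_projective
    obtain ⟨b, c, hbc⟩ := h.exists_ker_comp q hq
    -- U is a quotient of the kernel of Q → W, whose generation degree is controlled by H₁(W).
    refine homologyVanishing_zero_iff.2 (GeneratedLT.of_surjective ?_ c hbc.surj)
    exact ((IsSES.of_ker (q ≫ g) fun X => (h.surj X).comp (hq X)).homologyVanishing_left
      hQ hW).generatedLT
  | succ n ih =>
    obtain ⟨ih₁, ih₂, ih₃⟩ := ih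
    have middle (a : ℕ) {U V W : CMod k C} {f : U ⟶ V} {g : V ⟶ W} (h : IsSES f g)
        (hU : HomologyVanishing (n + 1) a U) (hW : HomologyVanishing (n + 1) a W) :
        HomologyVanishing (n + 1) a V := by
      have hV := h.generatedLT_middle hU.generatedLT hW.generatedLT
      obtain ⟨Q, q, _, hQ, hq⟩ := hV.exists_projective
      obtain ⟨b, c, hbc⟩ := h.exists_ker_comp q hq
      -- The middle term V has syzygy Z, the left term of the rotated sequence.
      refine (IsSES.of_ker q hq).homologyVanishing_right_of_projective hV (ih₂ a hbc ?_ hU)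
      exact (IsSES.of_ker (q ≫ g) fun X => (h.surj X).comp (hq X)).homologyVanishing_left
        (hQ.mono a.le_succ) hW
    refine ⟨middle, ?_, right (n + 1) middle⟩
    intro a U V W f g h hV hW
    obtain ⟨Q, q, _, hQ, hq⟩ := hV.generatedLT.exists_projective
    obtain ⟨b, c, hbc⟩ := h.exists_ker_comp q hq
    -- U is the right term of the rotated sequence, so the previous level applies with the degree
    -- bound raised by one.
    refine ih₃ (a + 1) hbc ((IsSES.of_ker q hq).homologyVanishing_left (hQ.mono (Nat.le_succ _)) hV)
      ?_
    exact (IsSES.of_ker (q ≫ g) fun X => (h.surj X).comp (hq X)).homologyVanishing_left hQ hW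

/-- The homology of `V` vanishes in homological degrees `i` and degrees `≥ a + i`, for all `i`;
that is, the regularity of `V` is less than `a`. -/
def RegLT (a : ℕ) (V : CMod k C) : Prop := ∀ n, HomologyVanishing n a V

lemma RegLT.mono {a b : ℕ} {V : CMod k C} (h : RegLT a V) (hab : a ≤ b) : RegLT b V :=
  fun n => (h n).mono le_rfl hab

lemma RegLT.generatedLT {a : ℕ} {V : CMod k C} (h : RegLT a V) : GeneratedLT a V :=
  (h 0).generatedLT

lemma RegLT.of_projective {V : CMod k C} [Projective V] {a : ℕ} (h : GeneratedLT a V) :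
    RegLT a V := HomologyVanishing.of_projective h

lemma IsSES.regLT_middle {U V W : CMod k C} {f : U ⟶ V} {g : V ⟶ W} (h : IsSES f g) {a : ℕ}
    (hU : RegLT a U) (hW : RegLT a W) : RegLT a V :=
  fun n => (homologyVanishing_middle_and_left n).1 a h (hU n) (hW n)

lemma IsSES.regLT_left {U V W : CMod k C} {f : U ⟶ V} {g : V ⟶ W} (h : IsSES f g) {a : ℕ}
    (hV : RegLT (a + 1) V) (hW : RegLT a W) : RegLT (a + 1) U :=
  fun n => (homologyVanishing_middle_and_left n).2.1 a h (hV n) (hW (n + 1))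

lemma IsSES.regLT_right {U V W : CMod k C} {f : U ⟶ V} {g : V ⟶ W} (h : IsSES f g) {a : ℕ}
    (hU : RegLT (a + 1) U) (hV : RegLT a V) : RegLT a W :=
  fun n => ((homologyVanishing_middle_and_left n).2.2 a h (hU n) (hV (n + 1))).mono
    n.le_succ le_rfl

lemma regLT_of_subsingleton {V : CMod k C} (h : ∀ X, Subsingleton (V.obj.obj X)) (a : ℕ) :
    RegLT a V := by
  have : Projective V := IsZero.projective ((IsZero.iff_id_eq_zero _).2
    (hom_ext_apply fun X x => (h X).elim _ _))
  exact RegLT.of_projective ((generatedLT_zero_iff.2 h).mono a.zero_le)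

/-- `RegLT` is a strict bound, hence the `a + 1`. -/
lemma regLT_of_reg_le {V : CMod k C} {a : ℕ} (h : reg V ≤ (a : EReal)) : RegLT (a + 1) V := by
  intro n i _ X hX
  by_contra hs
  rw [not_subsingleton_iff_nontrivial] at hs
  obtain ⟨s, rfl⟩ := (ob k (C := C)).surjective X
  rw [deg_ob] at hX
  have h1 : ((s : ℕ) : EReal) ≤ hd i V := le_sSup (Or.inr ⟨s, hs, rfl⟩)
  have h2 : hd i V - i ≤ (a : EReal) := (le_iSup (fun i : ℕ => hd i V - i) i).trans h
  have h3 : ((s : ℕ) : EReal) - (i : EReal) ≤ (a : EReal) :=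
    (EReal.sub_le_sub h1 le_rfl).trans h2
  have h4 : (((s : ℝ) - (i : ℝ) : ℝ) : EReal) ≤ ((a : ℝ) : EReal) := by
    rwa [EReal.coe_sub, EReal.coe_natCast, EReal.coe_natCast, EReal.coe_natCast]
  rw [EReal.coe_le_coe_iff] at h4
  have : (s : ℝ) ≤ ((a + i : ℕ) : ℝ) := by push_cast; linarith
  have := Nat.cast_le.1 this
  lia

lemma RegLT.reg_lt_top {V : CMod k C} {a : ℕ} (h : RegLT a V) : reg V < ⊤ := by
  refine lt_of_le_of_lt (iSup_le fun i => ?_) (EReal.coe_lt_top (a : ℝ))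
  have h1 : hd i V ≤ (((a : ℝ) + (i : ℝ) : ℝ) : EReal) := by
    refine sSup_le ?_
    rintro _ (rfl | ⟨s, hs, rfl⟩)
    -- The default value -1 of `hd` lies below any a + i.
    · have : ((-1 : ℝ) : EReal) ≤ (((a : ℝ) + (i : ℝ) : ℝ) : EReal) := by
        rw [EReal.coe_le_coe_iff]
        have := (a.cast_nonneg : (0 : ℝ) ≤ a)
        have := (i.cast_nonneg : (0 : ℝ) ≤ i)
        linarith
      rwa [EReal.coe_neg, EReal.coe_one] at this
    · have hlt : s < a + i := by
        by_contra hlt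
        have := h i i le_rfl (ob k s) (by rw [deg_ob]; lia)
        exact not_subsingleton _ this
      have : ((s : ℝ) : EReal) ≤ (((a : ℝ) + (i : ℝ) : ℝ) : EReal) := by
        rw [EReal.coe_le_coe_iff]
        exact_mod_cast hlt.le
      exact_mod_cast this
  refine (EReal.sub_le_sub h1 le_rfl).trans ?_
  rw [← EReal.coe_natCast, ← EReal.coe_sub, add_sub_cancel_right]

end Regularity

/-! ### Shift, translation maps and the derivative. -/

section Derivative

variable {k : Type u} [CommRing k] {C : Type w} [Category.{v} C] [Preadditive C] [Linear k C]
  [DirectedLinearCategory k C]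

/-- The morphism from `M(s)` corresponding to an element of degree `s`. -/
def liftM {s : ℕ} {V : CMod k C} (x : V.obj.obj (ob k s)) : M k C s ⟶ V :=
  ObjectProperty.homMk
    { app X := ModuleCat.ofHom
        { toFun f := V.obj.map f x
          map_add' f g := map_add_apply V f g x
          map_smul' r f := map_smul_apply V f r x }
      naturality X Y f := by
        ext g
        exact map_comp_apply V g f x }

lemma liftM_apply {s : ℕ} {V : CMod k C} (x : V.obj.obj (ob k s)) {X : C} (f : ob k s ⟶ X) :
    (liftM x).hom.app X f = V.obj.map f x := rfl

namespace SelfEmbedding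

variable (ι : SelfEmbedding k C)

lemma deg_obj (X : C) : deg k (ι.functor.obj X) = deg k X + 1 := by
  obtain ⟨s, rfl⟩ := (ob k (C := C)).surjective X
  rw [ι.obj_ob, deg_ob, deg_ob]

lemma exists_obj_eq {X : C} (h : deg k X ≠ 0) : ∃ Y, ι.functor.obj Y = X := by
  obtain ⟨s, rfl⟩ := (ob k (C := C)).surjective X
  rw [deg_ob] at h
  obtain ⟨s, rfl⟩ := Nat.exists_eq_succ_of_ne_zero h
  exact ⟨ob k s, ι.obj_ob s⟩

lemma shift_isSES {U V W : CMod k C} {f : U ⟶ V} {g : V ⟶ W} (h : IsSES f g) :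
    IsSES (ι.shift.map f) (ι.shift.map g) :=
  ⟨fun X => h.inj (ι.functor.obj X), fun X => h.exact (ι.functor.obj X),
    fun X => h.surj (ι.functor.obj X)⟩

/-- A morphism f acts on SV as ι(f) acts on V, and degrees in V exceed those in SV by one; degree 0
of V, which SV does not see, lies below the bound `a + 1`. -/
lemma generatedLT_of_shift {V : CMod k C} {a : ℕ} (h : GeneratedLT a (ι.shift.obj V)) :
    GeneratedLT (a + 1) V := by
  intro X hX
  obtain ⟨X, rfl⟩ := ι.exists_obj_eq (X := X) (by lia)
  rw [ι.deg_obj] at hX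
  rw [eq_top_iff]
  intro x _
  have hx : (show (ι.shift.obj V).obj.obj X from x) ∈ mSub (ι.shift.obj V) X := by
    rw [h X (by lia)]
    trivial
  refine Submodule.span_induction
    (p := fun y _ => (show V.obj.obj (ι.functor.obj X) from y) ∈ mSub V (ι.functor.obj X))
    ?_ (zero_mem (mSub V (ι.functor.obj X)))
    (fun y z _ _ hy hz => add_mem (S := Submodule k (V.obj.obj (ι.functor.obj X))) hy hz)
    (fun r y _ hy => (mSub V (ι.functor.obj X)).smul_mem r hy) hx
  rintro _ ⟨Y, f, x, hY, rfl⟩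
  refine Submodule.subset_span ⟨ι.functor.obj Y, ι.functor.map f, x, ?_, rfl⟩
  rw [ι.deg_obj, ι.deg_obj]
  lia

variable {ι} (e : 𝟭 C ⟶ ι.functor)

/-- The map `V(X) ⟶ V(ι(X))` given by the action of a natural transformation `Id ⟶ ι`. -/
def translate (V : CMod k C) (X : C) : V.obj.obj X →ₗ[k] V.obj.obj (ι.functor.obj X) :=
  (V.obj.map (e.app X : X ⟶ ι.functor.obj X)).hom

lemma translate_apply (V : CMod k C) {X : C} (x : V.obj.obj X) :
    translate e V X x = V.obj.map (e.app X : X ⟶ ι.functor.obj X) x := rfl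

lemma translate_map (V : CMod k C) {X Y : C} (f : X ⟶ Y) (x : V.obj.obj X) :
    translate e V Y (V.obj.map f x) = V.obj.map (ι.functor.map f) (translate e V X x) := by
  rw [translate_apply, translate_apply, ← map_comp_apply, ← map_comp_apply]
  exact congrArg (fun f : X ⟶ ι.functor.obj Y => V.obj.map f x) (e.naturality f)

lemma app_translate {V W : CMod k C} (p : V ⟶ W) {X : C} (x : V.obj.obj X) :
    p.hom.app (ι.functor.obj X) (translate e V X x) = translate e W X (p.hom.app X x) :=
  app_map_apply p _ x

/-- The morphism from a `C`-module to its shift given by a natural transformation `Id ⟶ ι`. -/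
def toShift (V : CMod k C) : V ⟶ ι.shift.obj V :=
  ObjectProperty.homMk
    { app X := ModuleCat.ofHom (translate e V X)
      naturality X Y f := by
        ext x
        exact translate_map e V f x }

/-- The derivative of a `C`-module: the cokernel of the morphism to its shift. -/
def derivative (V : CMod k C) : CMod k C := (CSubmodule.range (toShift e V)).quot

/-- The projection from the shift to the derivative. -/
def toDerivative (V : CMod k C) (X : C) :
    V.obj.obj (ι.functor.obj X) →ₗ[k] (derivative e V).obj.obj X :=
  ((CSubmodule.range (toShift e V)).proj.hom.app X).hom

lemma toDerivative_surjective (V : CMod k C) (X : C) :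
    Function.Surjective (toDerivative e V X) :=
  (CSubmodule.range (toShift e V)).proj_surjective X

lemma toDerivative_eq_zero_iff {V : CMod k C} {X : C} {x : V.obj.obj (ι.functor.obj X)} :
    toDerivative e V X x = 0 ↔ ∃ y, translate e V X y = x :=
  (CSubmodule.range (toShift e V)).proj_eq_zero_iff x

lemma toDerivative_translate {V : CMod k C} {X : C} (x : V.obj.obj X) :
    toDerivative e V X (translate e V X x) = 0 :=
  (toDerivative_eq_zero_iff e).2 ⟨x, rfl⟩

lemma map_toDerivative (V : CMod k C) {X Y : C} (f : X ⟶ Y) (x : V.obj.obj (ι.functor.obj X)) :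
    (derivative e V).obj.map f (toDerivative e V X x) =
      toDerivative e V Y (V.obj.map (ι.functor.map f) x) := rfl

/-- The morphism between derivatives induced by a morphism of `C`-modules. -/
def derivativeMap {V W : CMod k C} (p : V ⟶ W) : derivative e V ⟶ derivative e W :=
  CSubmodule.desc _ (ι.shift.map p ≫ (CSubmodule.range (toShift e W)).proj) (by
    rintro X _ ⟨x, rfl⟩
    exact (CSubmodule.proj_eq_zero_iff _ _).2 ⟨p.hom.app X x, (app_translate e p x).symm⟩)

lemma derivativeMap_apply {V W : CMod k C} (p : V ⟶ W) {X : C}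
    (x : V.obj.obj (ι.functor.obj X)) :
    (derivativeMap e p).hom.app X (toDerivative e V X x) =
      toDerivative e W X (p.hom.app (ι.functor.obj X) x) := rfl

/-- Snake lemma: the only obstruction to exactness on the left comes from the kernel of W → SW. -/
lemma derivative_isSES {U V W : CMod k C} {f : U ⟶ V} {g : V ⟶ W} (h : IsSES f g)
    (hW : ∀ X, Function.Injective (translate e W X)) :
    IsSES (derivativeMap e f) (derivativeMap e g) where
  inj X := by
    refine (injective_iff_map_eq_zero _).2 fun x hx => ?_
    obtain ⟨x, rfl⟩ := toDerivative_surjective e U X x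
    rw [derivativeMap_apply, toDerivative_eq_zero_iff] at hx
    obtain ⟨y, hy⟩ := hx
    obtain ⟨z, rfl⟩ := (h.exact X y).1 (hW X (by
      rw [map_zero, ← app_translate, hy, h.apply_apply]))
    rw [← app_translate] at hy
    rw [← h.inj _ hy, toDerivative_translate]
  exact X x := by
    obtain ⟨x, rfl⟩ := toDerivative_surjective e V X x
    constructor
    · intro hx
      rw [derivativeMap_apply, toDerivative_eq_zero_iff] at hx
      obtain ⟨y, hy⟩ := hx
      obtain ⟨y, rfl⟩ := h.surj X y
      obtain ⟨z, hz⟩ := (h.exact _ (x - translate e V X y)).1 (by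
        rw [map_sub, app_translate, hy, sub_self])
      refine ⟨toDerivative e U X z, ?_⟩
      rw [derivativeMap_apply, hz, map_sub, toDerivative_translate, sub_zero]
    · rintro ⟨y, hy⟩
      obtain ⟨y, rfl⟩ := toDerivative_surjective e U X y
      rw [← hy, derivativeMap_apply, derivativeMap_apply, h.apply_apply, map_zero]
  surj X y := by
    obtain ⟨y, rfl⟩ := toDerivative_surjective e W X y
    obtain ⟨x, rfl⟩ := h.surj _ y
    exact ⟨toDerivative e V X x, derivativeMap_apply e g x⟩

lemma toShift_isSES (V : CMod k C) (hV : ∀ X, Function.Injective (translate e V X)) :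
    IsSES (toShift e V) (CSubmodule.range (toShift e V)).proj where
  inj := hV
  exact _ x := (CSubmodule.range (toShift e V)).proj_eq_zero_iff x
  surj := CSubmodule.proj_surjective _

/-- Modulo translates, generation in DV lifts along ι; the translates themselves lie in 𝔪V because
`e` raises the degree by one. -/
lemma generatedLT_of_derivative {V : CMod k C} {a : ℕ} (h : GeneratedLT a (derivative e V)) :
    GeneratedLT (a + 1) V := by
  intro X hX
  obtain ⟨X, rfl⟩ := ι.exists_obj_eq (X := X) (by lia)
  rw [ι.deg_obj] at hX
  rw [eq_top_iff]
  intro x _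
  have key : mSub (derivative e V) X ≤
      (mSub V (ι.functor.obj X)).map (toDerivative e V X) := by
    refine Submodule.span_le.2 ?_
    rintro _ ⟨Y, f, y, hY, rfl⟩
    obtain ⟨y, rfl⟩ := toDerivative_surjective e V Y y
    refine ⟨V.obj.map (ι.functor.map f) y, Submodule.subset_span
      ⟨ι.functor.obj Y, ι.functor.map f, y, ?_, rfl⟩, (map_toDerivative e V f y).symm⟩
    rw [ι.deg_obj, ι.deg_obj]
    lia
  obtain ⟨y, hy, hyx⟩ := key (x := toDerivative e V X x) (by rw [h X (by lia)]; trivial)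
  obtain ⟨z, hz⟩ := (toDerivative_eq_zero_iff e (x := x - y)).1 (by
    rw [map_sub, hyx, sub_self])
  rw [← sub_add_cancel x y, ← hz]
  refine add_mem (Submodule.subset_span ⟨X, e.app X, z, ?_, rfl⟩) hy
  rw [ι.deg_obj]
  lia

end SelfEmbedding

lemma GeneratedLT.span_eq_top {n : ℕ} {V : CMod k C} (h : GeneratedLT n V) (X : C) :
    Submodule.span k {y | ∃ s, s < n ∧ ∃ (f : ob k s ⟶ X) (x : V.obj.obj (ob k s)),
      V.obj.map f x = y} = ⊤ := by
  let N : CSubmodule V :=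
    { carrier X := Submodule.span k {y | ∃ s, s < n ∧ ∃ (f : ob k s ⟶ X)
        (x : V.obj.obj (ob k s)), V.obj.map f x = y}
      map_mem {X Y} g y hy := by
        have : Submodule.span k {y | ∃ s, s < n ∧ ∃ (f : ob k s ⟶ X)
            (x : V.obj.obj (ob k s)), V.obj.map f x = y} ≤
            (Submodule.span k {y | ∃ s, s < n ∧ ∃ (f : ob k s ⟶ Y)
              (x : V.obj.obj (ob k s)), V.obj.map f x = y}).comap (V.obj.map g).hom := by
          refine Submodule.span_le.2 ?_
          rintro _ ⟨s, hs, f, x, rfl⟩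
          exact Submodule.subset_span ⟨s, hs, f ≫ g, x, map_comp_apply V f g x⟩
        exact this hy }
  refine h.eq_top N (fun Y hY => ?_) X
  obtain ⟨s, rfl⟩ := (ob k (C := C)).surjective Y
  rw [deg_ob] at hY
  rw [eq_top_iff]
  intro x _
  exact Submodule.subset_span ⟨s, hY, 𝟙 _, x, by simp⟩

namespace SelfEmbedding

variable {ι : SelfEmbedding k C}

/-- Each x of degree s ≤ n gives M(s) → V, hence DM(s) → DV, and DM(s) is generated in degrees < s.
The images of these maps span DV. -/
lemma generatedLT_derivative {e : 𝟭 C ⟶ ι.functor}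
    (he : ∀ s, GeneratedLT s (derivative e (M k C s))) {n : ℕ} {V : CMod k C}
    (h : GeneratedLT (n + 1) V) : GeneratedLT n (derivative e V) := by
  intro X hX
  rw [eq_top_iff]
  intro z _
  obtain ⟨z, rfl⟩ := toDerivative_surjective e V X z
  have key : Submodule.span k {y | ∃ s, s < n + 1 ∧ ∃ (f : ob k s ⟶ ι.functor.obj X)
      (x : V.obj.obj (ob k s)), V.obj.map f x = y} ≤
      (mSub (derivative e V) X).comap (toDerivative e V X) := by
    refine Submodule.span_le.2 ?_
    rintro _ ⟨s, hs, f, x, rfl⟩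
    have := mSub_le_comap_app (derivativeMap e (liftM x)) X
      (x := toDerivative e (M k C s) X f) (by rw [he s X (by lia)]; trivial)
    exact this
  exact key (by rw [h.span_eq_top]; trivial)

/-- A generic shift functor is induced by a natural transformation `Id ⟶ ι` consisting of
monomorphisms. -/
lemma IsGeneric.exists_natTrans (hι : ι.IsGeneric) :
    ∃ e : 𝟭 C ⟶ ι.functor,
      (∀ (s : ℕ) (X : C), Function.Injective (translate e (M k C s) X)) ∧
      ∀ s, GeneratedLT s (derivative e (M k C s)) := by
  obtain ⟨μ, hμ⟩ := hι
  have h1 (X : C) : ∃ f : X ⟶ ι.functor.obj X, ∀ (V : CMod k C) (x : V.obj.obj X),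
      (μ.app V).hom.app X x = V.obj.map f x := by
    obtain ⟨s, rfl⟩ := (ob k (C := C)).surjective X
    -- Yoneda: the component of `e` is the image of the identity of s under `μ` on M(s).
    refine ⟨(μ.app (M k C s)).hom.app (ob k s) (𝟙 (ob k s)), fun V x => ?_⟩
    have := congrArg (fun p : M k C s ⟶ ι.shift.obj V => p.hom.app (ob k s) (𝟙 (ob k s)))
      (μ.naturality (liftM x))
    refine Eq.trans ?_ this
    refine congrArg ((μ.app V).hom.app (ob k s)) ?_
    exact (congrArg (fun f : V.obj.obj (ob k s) ⟶ V.obj.obj (ob k s) => f x)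
      (V.obj.map_id (ob k s))).symm
  choose f hf using h1
  let e : 𝟭 C ⟶ ι.functor :=
    { app := f
      naturality X Y g := by
        obtain ⟨s, rfl⟩ := (ob k (C := C)).surjective X
        have := app_map_apply (μ.app (M k C s)) g (𝟙 (ob k s))
        replace this := (hf _ _ _).symm.trans (this.trans
          (congrArg ((ι.shift.obj (M k C s)).obj.map g) (hf _ _ _)))
        change (𝟙 (ob k s) ≫ g) ≫ f Y = (𝟙 (ob k s) ≫ f (ob k s)) ≫ ι.functor.map g at this
        rwa [Category.id_comp, Category.id_comp] at this }
  have hμe (V : CMod k C) : μ.app V = toShift e V := hom_ext_apply fun X x => hf X V x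
  refine ⟨e, fun s X => ?_, fun s => ?_⟩
  · have := (hμ s).1 X
    rw [hμe] at this
    exact this
  · have hgen : IsGeneratedInDegreesLE (cokernel (toShift e (M k C s))) ((s : ℤ) - 1) := by
      have := (hμ s).2
      simp only [hμe] at this
      exact this
    let N := CSubmodule.range (toShift e (M k C s))
    -- The hypothesis concerns the abstract cokernel; a surjection onto the concrete quotient is
    -- enough to transfer generation.
    let c : cokernel (toShift e (M k C s)) ⟶ N.quot := cokernel.desc _ N.proj
      (hom_ext_apply fun X x => (N.proj_eq_zero_iff _).2 ⟨x, rfl⟩)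
    have hc (X : C) : Function.Surjective (c.hom.app X) := by
      intro y
      obtain ⟨x, rfl⟩ := N.proj_surjective X y
      refine ⟨(cokernel.π (toShift e (M k C s))).hom.app X x, ?_⟩
      rw [← app_comp_apply, cokernel.π_desc]
    refine GeneratedLT.of_surjective (generatedLT_of_forall_eq_top fun K hK => ?_) c hc
    refine hgen K fun r hr => hK _ ?_
    rw [deg_ob]
    lia

end SelfEmbedding

end Derivative

/-! ### Modules with finitely generated values. -/

section Finiteness

variable {k : Type u} [CommRing k] {C : Type w} [Category.{v} C] [Preadditive C] [Linear k C]

/-- The values of a `C`-module are finitely generated. -/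
def PointwiseFinite (V : CMod k C) : Prop := ∀ X, Module.Finite k (V.obj.obj X)

lemma PointwiseFinite.of_surjective {V W : CMod k C} (h : PointwiseFinite V) (p : V ⟶ W)
    (hp : ∀ X, Function.Surjective (p.hom.app X)) : PointwiseFinite W := fun X =>
  have := h X
  Module.Finite.of_surjective (p.hom.app X).hom (hp X)

lemma PointwiseFinite.toCMod [IsNoetherianRing k] {V : CMod k C} (h : PointwiseFinite V)
    (N : CSubmodule V) : PointwiseFinite N.toCMod := fun X =>
  have := h X
  inferInstanceAs (Module.Finite k (N.carrier X))

lemma IsSES.pointwiseFinite {U V W : CMod k C} {f : U ⟶ V} {g : V ⟶ W} (h : IsSES f g)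
    (hU : PointwiseFinite U) (hW : PointwiseFinite W) : PointwiseFinite V := fun X =>
  have := hU X
  have := hW X
  Module.Finite.of_exact (f := (f.hom.app X).hom) (g := (g.hom.app X).hom) (h.exact X) (h.surj X)

lemma isSES_biprod (V W : CMod k C) : IsSES (biprod.inl : V ⟶ V ⊞ W) biprod.snd where
  inj X := Function.LeftInverse.injective (g := (biprod.fst : V ⊞ W ⟶ V).hom.app X) fun x => by
    rw [← app_comp_apply, biprod.inl_fst]
    rfl
  exact X x := by
    constructor
    · intro hx
      refine ⟨(biprod.fst : V ⊞ W ⟶ V).hom.app X x, ?_⟩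
      have : (biprod.fst ≫ biprod.inl + biprod.snd ≫ biprod.inr : V ⊞ W ⟶ V ⊞ W).hom.app X x = x := by
        rw [biprod.total]
        rfl
      refine Eq.trans ?_ this
      change _ = (biprod.inl : V ⟶ V ⊞ W).hom.app X ((biprod.fst : V ⊞ W ⟶ V).hom.app X x) +
        (biprod.inr : W ⟶ V ⊞ W).hom.app X ((biprod.snd : V ⊞ W ⟶ W).hom.app X x)
      rw [hx, map_zero, add_zero]
    · rintro ⟨y, rfl⟩
      rw [← app_comp_apply, biprod.inl_snd]
      rfl
  surj X := Function.RightInverse.surjective (g := (biprod.inr : W ⟶ V ⊞ W).hom.app X) fun x => by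
    rw [← app_comp_apply, biprod.inr_snd]
    rfl

end Finiteness

/-! ### The ascending chain condition. -/

section Noetherian

variable {k : Type u} [CommRing k] {C : Type w} [Category.{v} C] [Preadditive C] [Linear k C]
  [DirectedLinearCategory k C] {ι : SelfEmbedding k C} (e : 𝟭 C ⟶ ι.functor)

namespace CSubmodule

variable {V : CMod k C}

/-- The inverse image of a `C`-submodule under the action of a natural transformation
`Id ⟶ ι`. -/
def preTranslate (N : CSubmodule V) : CSubmodule V where
  carrier X := (N.carrier (ι.functor.obj X)).comap (SelfEmbedding.translate e V X)
  map_mem {X Y} f x hx := by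
    rw [Submodule.mem_comap, SelfEmbedding.translate_map]
    exact N.map_mem _ hx

lemma mem_preTranslate {N : CSubmodule V} {X : C} {x : V.obj.obj X} :
    x ∈ (N.preTranslate e).carrier X ↔
      SelfEmbedding.translate e V X x ∈ N.carrier (ι.functor.obj X) := Iff.rfl

lemma le_preTranslate (N : CSubmodule V) : N ≤ N.preTranslate e :=
  fun _ _ hx => N.map_mem _ hx

lemma preTranslate_mono : Monotone (preTranslate e : CSubmodule V → CSubmodule V) :=
  fun _ _ h X _ hx => h (ι.functor.obj X) hx

/-- The image of a `C`-submodule in the derivative. -/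
def symbol (N : CSubmodule V) : CSubmodule (SelfEmbedding.derivative e V) where
  carrier X := (N.carrier (ι.functor.obj X)).map (SelfEmbedding.toDerivative e V X)
  map_mem {X Y} f x hx := by
    obtain ⟨x, hx, rfl⟩ := hx
    exact ⟨V.obj.map (ι.functor.map f) x, N.map_mem _ hx, SelfEmbedding.map_toDerivative e V f x⟩

lemma symbol_mono : Monotone (symbol e : CSubmodule V → _) :=
  fun _ _ h X => Submodule.map_mono (h (ι.functor.obj X))

/-- A `C`-submodule is determined by the symbols and the degree `0` parts of its iterated
inverse images. -/
lemma le_of_symbol_le {N N' : CSubmodule V} (h : N ≤ N')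
    (hs : ∀ j, symbol e ((preTranslate e)^[j] N') ≤ symbol e ((preTranslate e)^[j] N))
    (h0 : ∀ j, ((preTranslate e)^[j] N').carrier (ob k 0) ≤
      ((preTranslate e)^[j] N).carrier (ob k 0)) : N' ≤ N := by
  suffices ∀ (d : ℕ) (X : C), deg k X = d → N'.carrier X ≤ N.carrier X from
    fun X => this _ X rfl
  intro d
  induction d generalizing N N' with
  | zero =>
    intro X hX
    obtain ⟨s, rfl⟩ := (ob k (C := C)).surjective X
    rw [deg_ob] at hX
    subst hX
    exact h0 0
  | succ d ih =>
    intro X hX x hx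
    obtain ⟨X, rfl⟩ := ι.exists_obj_eq (X := X) (by lia)
    rw [ι.deg_obj] at hX
    -- Cancel the symbol of x by some y in N. The difference is the translate of an element z one
    -- degree lower, which lies in the inverse image of N'; induction puts z in that of N.
    obtain ⟨y, hy, hyx⟩ := hs 0 X ⟨x, hx, rfl⟩
    obtain ⟨z, hz⟩ := (SelfEmbedding.toDerivative_eq_zero_iff e (x := x - y)).1 (by
      rw [map_sub, hyx, sub_self])
    have hz' : z ∈ (N'.preTranslate e).carrier X := by
      rw [mem_preTranslate, hz]
      exact sub_mem hx (h _ hy)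
    have := ih (preTranslate_mono e h) (fun j => hs (j + 1)) (fun j => h0 (j + 1)) X
      (by lia) hz'
    rw [← sub_add_cancel x y, ← hz]
    exact add_mem this hy

end CSubmodule

/-- The diagonal stabilizes at some N₀, which handles all rows j ≥ N₀ at once; the finitely many
remaining rows stabilize individually. The bound is uniform in j. -/
lemma exists_forall_le_of_wellFoundedGT {α : Type*} [PartialOrder α] [WellFoundedGT α]
    (f : ℕ → ℕ → α) (h₁ : ∀ n, Monotone fun j => f j n) (h₂ : ∀ j, Monotone (f j)) :
    ∃ N, ∀ j n, N ≤ n → f j n ≤ f j N := by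
  obtain ⟨N₀, hN₀⟩ := WellFoundedGT.monotone_chain_condition
    (⟨fun n => f n n, fun m n h => (h₁ m h).trans (h₂ n h)⟩ : ℕ →o α)
  choose N hN using fun j => WellFoundedGT.monotone_chain_condition (⟨f j, h₂ j⟩ : ℕ →o α)
  refine ⟨max N₀ ((Finset.range N₀).sup N), fun j n hn => ?_⟩
  by_cases hj : j < N₀
  · have hNj : N j ≤ max N₀ ((Finset.range N₀).sup N) :=
      le_max_of_le_right (Finset.le_sup (Finset.mem_range.2 hj))
    exact ((hN j _ (hNj.trans hn)).symm.trans (hN j _ hNj)).le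
  · have h := hN₀ (max j n) (by lia)
    calc f j n ≤ f (max j n) (max j n) :=
          (h₂ j (le_max_right j n)).trans (h₁ _ (le_max_left j n))
      _ = f N₀ N₀ := h.symm
      _ ≤ f j N₀ := h₁ _ (not_lt.1 hj)
      _ ≤ _ := h₂ j (le_max_left _ _)

/-- Hilbert's basis theorem with translation as the variable: the symbols of the iterated inverse
images play the role of leading-coefficient ideals. They increase in both j and n, so they stabilize
uniformly, as do the degree 0 parts. -/
lemma wellFoundedGT_of_derivative (V : CMod k C) (h0 : IsNoetherian k (V.obj.obj (ob k 0)))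
    [WellFoundedGT (CSubmodule (SelfEmbedding.derivative e V))] :
    WellFoundedGT (CSubmodule V) := by
  rw [wellFoundedGT_iff_monotone_chain_condition]
  intro U
  have mono₁ (n : ℕ) : Monotone fun j => (CSubmodule.preTranslate e)^[j] (U n) :=
    monotone_nat_of_le_succ fun j => by
      rw [Function.iterate_succ_apply']
      exact CSubmodule.le_preTranslate e _
  have mono₂ (j : ℕ) : Monotone fun n => (CSubmodule.preTranslate e)^[j] (U n) :=
    ((CSubmodule.preTranslate_mono e).iterate j).comp U.monotone
  obtain ⟨N, hN⟩ := exists_forall_le_of_wellFoundedGT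
    (fun j n => CSubmodule.symbol e ((CSubmodule.preTranslate e)^[j] (U n)))
    (fun n => (CSubmodule.symbol_mono e).comp (mono₁ n))
    (fun j => (CSubmodule.symbol_mono e).comp (mono₂ j))
  obtain ⟨N', hN'⟩ := exists_forall_le_of_wellFoundedGT
    (fun j n => ((CSubmodule.preTranslate e)^[j] (U n)).carrier (ob k 0))
    (fun n _ _ h => mono₁ n h _) (fun j _ _ h => mono₂ j h _)
  refine ⟨max N N', fun m hm => le_antisymm (U.monotone hm) ?_⟩
  refine CSubmodule.le_of_symbol_le e (U.monotone hm) (fun j => ?_) (fun j => ?_)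
  · exact (hN j m ((le_max_left _ _).trans hm)).trans
      ((CSubmodule.symbol_mono e).comp (mono₂ j) (le_max_left N N'))
  · exact (hN' j m ((le_max_right _ _).trans hm)).trans (mono₂ j (le_max_right N N') _)

variable {e}

lemma PointwiseFinite.derivative {V : CMod k C} (h : PointwiseFinite V) :
    PointwiseFinite (SelfEmbedding.derivative e V) := fun X =>
  have := h (ι.functor.obj X)
  Module.Finite.of_surjective _ (SelfEmbedding.toDerivative_surjective e V X)

/-- A finitely generated `C`-module satisfies the ascending chain condition. -/
theorem PointwiseFinite.wellFoundedGT [IsNoetherianRing k]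
    (he : ∀ s, GeneratedLT s (SelfEmbedding.derivative e (M k C s))) {n : ℕ} {V : CMod k C}
    (hV : PointwiseFinite V) (hn : GeneratedLT n V) : WellFoundedGT (CSubmodule V) := by
  induction n generalizing V with
  | zero =>
    have := generatedLT_zero_iff.1 hn
    have (N N' : CSubmodule V) : N = N' := by
      ext X x
      rw [Subsingleton.elim x 0]
      exact ⟨fun _ => zero_mem _, fun _ => zero_mem _⟩
    have : Subsingleton (CSubmodule V) := ⟨this⟩
    infer_instance
  | succ n ih =>
    have := ih hV.derivative (SelfEmbedding.generatedLT_derivative he hn)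
    have := hV (ob k 0)
    exact wellFoundedGT_of_derivative e V inferInstance

end Noetherian

/-! ### Finite free modules and finite covers. -/

section Free

variable {k : Type u} [CommRing k] {C : Type w} [Category.{v} C] [Preadditive C] [Linear k C]
  [DirectedLinearCategory k C]

lemma generatedLT_M (s : ℕ) : GeneratedLT (s + 1) (M k C s) := by
  intro X hX
  rw [eq_top_iff]
  intro f _
  refine Submodule.subset_span ⟨ob k s, f, 𝟙 (ob k s), by rw [deg_ob]; lia, ?_⟩
  exact Category.id_comp (f : ob k s ⟶ X)

instance (s : ℕ) : Projective (M k C s) where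
  factors {E W} f p _ := by
    obtain ⟨y, hy⟩ := surjective_of_epi p (ob k s) (f.hom.app (ob k s) (𝟙 (ob k s)))
    refine ⟨liftM y, hom_ext_apply fun X φ => ?_⟩
    rw [app_comp_apply]
    refine (app_map_apply p φ y).trans ?_
    rw [hy]
    refine (app_map_apply f φ (𝟙 (ob k s))).symm.trans (congrArg (f.hom.app X) ?_)
    exact Category.id_comp φ

lemma pointwiseFinite_M (s : ℕ) : PointwiseFinite (M k C s) := fun X => by
  obtain ⟨r, rfl⟩ := (ob k (C := C)).surjective X
  exact finite_hom s r

open ZeroObject in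
variable (k C) in
/-- The finite direct sum of the `C`-modules `M(s)` for `s` in a list. -/
noncomputable def freeOn : List ℕ → CMod k C
  | [] => 0
  | s :: l => M k C s ⊞ freeOn l

/-- A property closed under extensions needs checking only on zero modules and on the M(s). -/
lemma freeOn_induction {p : CMod k C → Prop} (l : List ℕ)
    (zero : ∀ V : CMod k C, (∀ X, Subsingleton (V.obj.obj X)) → p V)
    (M : ∀ s ∈ l, p (M k C s))
    (ext : ∀ {U V W : CMod k C} {f : U ⟶ V} {g : V ⟶ W}, IsSES f g → p U → p W → p V) :
    p (freeOn k C l) := by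
  induction l with
  | nil => exact zero _ fun X =>
      ModuleCat.subsingleton_of_isZero ((evalAt k X).map_isZero (isZero_zero _))
  | cons s l ih =>
    exact ext (isSES_biprod _ _) (M s List.mem_cons_self)
      (ih fun t ht => M t (List.mem_cons_of_mem s ht))

instance (l : List ℕ) : Projective (freeOn k C l) := by
  induction l with
  | nil => exact (isZero_zero _).projective
  | cons s l ih => exact inferInstanceAs (Projective (M k C s ⊞ freeOn k C l))

lemma generatedLT_freeOn {l : List ℕ} {n : ℕ} (hl : ∀ s ∈ l, s < n) :
    GeneratedLT n (freeOn k C l) :=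
  freeOn_induction l (fun _ h => (generatedLT_zero_iff.2 h).mono n.zero_le)
    (fun s hs => (generatedLT_M s).mono (hl s hs)) fun h => h.generatedLT_middle

lemma pointwiseFinite_freeOn (l : List ℕ) : PointwiseFinite (freeOn k C l) :=
  freeOn_induction l (fun _ h X => have := h X; inferInstance)
    (fun s _ => pointwiseFinite_M s) IsSES.pointwiseFinite

lemma exists_freeOn_of_finite {V : CMod k C} {T : Set (Σ X : C, V.obj.obj X)} (hT : T.Finite) :
    ∃ l : List ℕ, (∀ s ∈ l, ∃ t ∈ T, deg k t.1 = s) ∧ ∃ p : freeOn k C l ⟶ V,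
      ∀ t ∈ T, ∃ y, p.hom.app t.1 y = t.2 := by
  induction T, hT using Set.Finite.induction_on with
  | empty => exact ⟨[], by simp, 0, by simp⟩
  | @insert t T _ _ ih =>
    obtain ⟨l, hl, p, hp⟩ := ih
    obtain ⟨X, x⟩ := t
    obtain ⟨s, rfl⟩ := (ob k (C := C)).surjective X
    refine ⟨s :: l, ?_, (biprod.desc (liftM x) p : M k C s ⊞ freeOn k C l ⟶ V), ?_⟩
    · intro r hr
      rcases List.mem_cons.1 hr with rfl | hr
      · exact ⟨_, Set.mem_insert _ _, deg_ob r⟩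
      · obtain ⟨t, ht, h⟩ := hl r hr
        exact ⟨t, Set.mem_insert_of_mem _ ht, h⟩
    · rintro t (rfl | ht)
      · refine ⟨(biprod.inl : M k C s ⟶ M k C s ⊞ freeOn k C l).hom.app _ (𝟙 (ob k s)), ?_⟩
        refine (app_comp_apply (biprod.inl : M k C s ⟶ M k C s ⊞ freeOn k C l) _ _).symm.trans ?_
        rw [biprod.inl_desc, liftM_apply]
        exact congrArg (fun f : V.obj.obj (ob k s) ⟶ V.obj.obj (ob k s) => f x)
          (V.obj.map_id (ob k s))
      · obtain ⟨y, hy⟩ := hp t ht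
        refine ⟨(biprod.inr : freeOn k C l ⟶ M k C s ⊞ freeOn k C l).hom.app _ y, ?_⟩
        refine (app_comp_apply (biprod.inr : freeOn k C l ⟶ M k C s ⊞ freeOn k C l) _ _).symm.trans
          ?_
        rw [biprod.inr_desc, hy]

lemma IsFinitelyGenerated.exists_freeOn {V : CMod k C} (h : IsFinitelyGenerated V) :
    ∃ (l : List ℕ) (p : freeOn k C l ⟶ V), ∀ X, Function.Surjective (p.hom.app X) := by
  obtain ⟨T, hT, h⟩ := h
  obtain ⟨l, _, p, hp⟩ := exists_freeOn_of_finite hT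
  exact ⟨l, p, fun X => LinearMap.range_eq_top.1 (h (CSubmodule.range p) hp X)⟩

/-- Finitely many generators of V_r for each r < n suffice. The cover is finite and its generators
stay in degrees < n, and regularity estimates need both. -/
lemma GeneratedLT.exists_freeOn {n : ℕ} {V : CMod k C} (h : GeneratedLT n V)
    (hV : PointwiseFinite V) :
    ∃ l : List ℕ, (∀ s ∈ l, s < n) ∧ ∃ p : freeOn k C l ⟶ V,
      ∀ X, Function.Surjective (p.hom.app X) := by
  choose S hS using fun X => (hV X).fg_top
  let T : Set (Σ X : C, V.obj.obj X) := ⋃ s ∈ Finset.range n, Sigma.mk (ob k s) '' (S (ob k s))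
  have hT : T.Finite := Set.Finite.biUnion (Finset.finite_toSet _) fun s _ =>
    (Finset.finite_toSet _).image _
  obtain ⟨l, hl, p, hp⟩ := exists_freeOn_of_finite hT
  refine ⟨l, fun s hs => ?_, p, fun X => LinearMap.range_eq_top.1
    (h.eq_top (CSubmodule.range p) (fun X hX => ?_) X)⟩
  · obtain ⟨t, ht, rfl⟩ := hl s hs
    simp only [T, Set.mem_iUnion] at ht
    obtain ⟨r, hr, x, _, rfl⟩ := ht
    rw [deg_ob]
    exact Finset.mem_range.1 hr
  · obtain ⟨s, rfl⟩ := (ob k (C := C)).surjective X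
    rw [deg_ob] at hX
    rw [eq_top_iff, ← hS]
    refine Submodule.span_le.2 fun x hx => hp ⟨ob k s, x⟩ ?_
    simp only [T, Set.mem_iUnion]
    exact ⟨s, Finset.mem_range.2 hX, x, hx, rfl⟩

end Free

/-! ### Descent of regularity and the double induction. -/

section Main

variable {k : Type u} [CommRing k] {C : Type w} [Category.{v} C] [Preadditive C] [Linear k C]
  [DirectedLinearCategory k C]

/-- A bound on the regularity of `V` in terms of the regularity of `T V`, for a construction `T`
which, on the class `P` of modules, behaves like the shift functor or like its derivative. -/
theorem homologyVanishing_of_transform [IsNoetherianRing k] (T : CMod k C → CMod k C)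
    (P : CMod k C → Prop)
    (hses : ∀ {U V W : CMod k C} {f : U ⟶ V} {g : V ⟶ W}, IsSES f g → P V → P W →
      P U ∧ ∃ (f' : T U ⟶ T V) (g' : T V ⟶ T W), IsSES f' g')
    (hgen : ∀ {V : CMod k C} {a : ℕ}, GeneratedLT a (T V) → GeneratedLT (a + 1) V)
    (hfree : ∀ (l : List ℕ) (a : ℕ), (∀ s ∈ l, s < a) →
      P (freeOn k C l) ∧ RegLT a (T (freeOn k C l)))
    (n : ℕ) {a : ℕ} {V : CMod k C} (hV : PointwiseFinite V) (hP : P V) (hT : RegLT a (T V)) :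
    HomologyVanishing n (a + 1) V := by
  induction n generalizing a V with
  | zero => exact homologyVanishing_zero_iff.2 (hgen hT.generatedLT)
  | succ n ih =>
    have hg := hgen hT.generatedLT
    obtain ⟨l, hl, p, hp⟩ := hg.exists_freeOn hV
    obtain ⟨hPl, hTl⟩ := hfree l (a + 1) hl
    have h := IsSES.of_ker p hp
    obtain ⟨hPK, f', g', h'⟩ := hses h hPl hP
    -- `T` of the syzygy has regularity < a + 1, so the induction applies with a + 1 in place of a;
    -- the loss of one degree is absorbed by the homological shift. Noetherianity of k keeps the
    -- syzygy pointwise finite.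
    exact h.homologyVanishing_right_of_projective hg
      (ih ((pointwiseFinite_freeOn l).toCMod _) hPK (h'.regLT_left hTl hT))

namespace SelfEmbedding

variable {ι : SelfEmbedding k C}

lemma regLT_shift_freeOn (hreg : ∀ s : ℕ, RegLT (s + 1) (ι.shift.obj (M k C s)))
    {l : List ℕ} {a : ℕ} (hl : ∀ s ∈ l, s < a) : RegLT a (ι.shift.obj (freeOn k C l)) :=
  freeOn_induction (p := fun V => RegLT a (ι.shift.obj V)) l
    (fun _ h => regLT_of_subsingleton (fun X => h (ι.functor.obj X)) a)
    (fun s hs => (hreg s).mono (hl s hs)) fun h => (ι.shift_isSES h).regLT_middle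

/-- If the shift of `V` has finite regularity, then so does `V`. -/
theorem regLT_of_shift [IsNoetherianRing k]
    (hreg : ∀ s : ℕ, RegLT (s + 1) (ι.shift.obj (M k C s))) {a : ℕ} {V : CMod k C}
    (hV : PointwiseFinite V) (h : RegLT a (ι.shift.obj V)) : RegLT (a + 1) V := fun n =>
  homologyVanishing_of_transform ι.shift.obj (fun _ => True)
    (fun h _ _ => ⟨trivial, _, _, ι.shift_isSES h⟩) ι.generatedLT_of_shift
    (fun _ _ hl => ⟨trivial, regLT_shift_freeOn hreg hl⟩) n hV trivial h

variable {e : 𝟭 C ⟶ ι.functor}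

lemma translate_freeOn_injective
    (he : ∀ (s : ℕ) (X : C), Function.Injective (translate e (M k C s) X)) (l : List ℕ) (X : C) :
    Function.Injective (translate e (freeOn k C l) X) := by
  refine freeOn_induction (p := fun V => ∀ X, Function.Injective (translate e V X)) l
    (fun V h X x y _ => (h X).elim x y) (fun s _ => he s) (fun {U V W f g} h hU hW X => ?_) X
  refine (injective_iff_map_eq_zero _).2 fun x hx => ?_
  obtain ⟨y, rfl⟩ := (h.exact X x).1 (hW X (by
    rw [map_zero, ← app_translate, hx, map_zero]))
  rw [← app_translate] at hx
  have := h.inj _ (hx.trans (map_zero _).symm)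
  rw [hU X (this.trans (map_zero _).symm), map_zero]

/-- If `V` embeds in its shift and its derivative has finite regularity, then so does `V`. -/
theorem regLT_of_derivative [IsNoetherianRing k]
    (hreg : ∀ s : ℕ, RegLT (s + 1) (ι.shift.obj (M k C s)))
    (he : ∀ (s : ℕ) (X : C), Function.Injective (translate e (M k C s) X))
    {a : ℕ} {V : CMod k C} (hV : PointwiseFinite V)
    (hinj : ∀ X, Function.Injective (translate e V X)) (h : RegLT a (derivative e V)) :
    RegLT (a + 1) V := fun n =>
  homologyVanishing_of_transform (derivative e)
    (fun V => ∀ X, Function.Injective (translate e V X))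
    (fun {U V W f g} h hV hW => ⟨fun X => by
      refine (injective_iff_map_eq_zero _).2 fun x hx => ?_
      refine h.inj X (hV X ?_)
      rw [← app_translate, hx, map_zero, map_zero, map_zero], _, _, derivative_isSES e h hW⟩)
    (generatedLT_of_derivative e)
    (fun l a hl => ⟨translate_freeOn_injective he l,
      -- For a free module P, the sequence 0 → P → SP → DP → 0 bounds reg DP.
      (toShift_isSES e _ (translate_freeOn_injective he l)).regLT_right
        ((RegLT.of_projective (generatedLT_freeOn hl)).mono a.le_succ)
        (regLT_shift_freeOn hreg hl)⟩) n hV hinj h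

lemma mem_ker_toShift {V : CMod k C} {X : C} {x : V.obj.obj X} :
    x ∈ (CSubmodule.ker (toShift e V)).carrier X ↔ translate e V X x = 0 := Iff.rfl

/-- Snake lemma for 0 → K → V → F → 0 mapping to its shift. As K → SK is zero, DK is SK, and as K is
the whole kernel on V, the connecting map ker(F → SF) → SK is injective. It sends the class of x to
the translate of x; its cokernel is ker(DV → DF). -/
lemma exists_lift_ker_derivativeMap (V : CMod k C) :
    let K := CSubmodule.ker (toShift e V)
    ∃ (a : (CSubmodule.ker (toShift e K.quot)).toCMod ⟶ ι.shift.obj K.toCMod)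
      (b : ι.shift.obj K.toCMod ⟶ (CSubmodule.ker (derivativeMap e K.proj)).toCMod),
      IsSES a b := by
  intro K
  let q : K.quot ⟶ ι.shift.obj V := K.desc (toShift e V) fun X x hx => hx
  have hq {X : C} (x : V.obj.obj X) : q.hom.app X (K.proj.hom.app X x) = translate e V X x := rfl
  have hincl (X : C) : Function.Injective ((ι.shift.map K.incl).hom.app X) :=
    fun x y h => Subtype.ext h
  have htr {X : C} (x : V.obj.obj X) :
      K.proj.hom.app X x ∈ (CSubmodule.ker (toShift e K.quot)).carrier X ↔
        translate e V X x ∈ K.carrier (ι.functor.obj X) := by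
    rw [mem_ker_toShift, ← app_translate, K.proj_eq_zero_iff]
  obtain ⟨a, ha⟩ := exists_lift_of_injective (ι.shift.map K.incl) hincl
    ((CSubmodule.ker (toShift e K.quot)).incl ≫ q) (by
      rintro X ⟨x, hx⟩
      obtain ⟨x, rfl⟩ := K.proj_surjective X x
      exact ⟨⟨translate e V X x, (htr x).1 hx⟩, rfl⟩)
  refine ⟨a, CSubmodule.lift _
    (ι.shift.map K.incl ≫ (CSubmodule.range (toShift e V)).proj) fun X x => ?_, ?_, ?_, ?_⟩
  · have hx : K.proj.hom.app (ι.functor.obj X) x.1 = 0 := (K.proj_eq_zero_iff _).2 x.2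
    exact (derivativeMap_apply e K.proj x.1).trans
      ((congrArg (toDerivative e K.quot X) hx).trans (map_zero _))
  · intro X
    refine (injective_iff_map_eq_zero _).2 ?_
    rintro ⟨x, hx⟩ h
    obtain ⟨x, rfl⟩ := K.proj_surjective X x
    have h1 : translate e V X x = 0 :=
      (ha X ⟨_, hx⟩).symm.trans ((congrArg _ h).trans (map_zero _))
    exact Subtype.ext ((K.proj_eq_zero_iff x).2 h1)
  · rintro X ⟨x, hx⟩
    constructor
    · intro h
      have h1 : toDerivative e V X x = 0 := congrArg Subtype.val h
      obtain ⟨y, rfl⟩ := (toDerivative_eq_zero_iff e).1 h1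
      exact ⟨⟨K.proj.hom.app X y, (htr y).2 hx⟩, hincl X (ha X _)⟩
    · rintro ⟨⟨y, hy⟩, h⟩
      obtain ⟨y, rfl⟩ := K.proj_surjective X y
      have h1 : translate e V X y = x :=
        (ha X ⟨_, hy⟩).symm.trans (congrArg ((ι.shift.map K.incl).hom.app X) h)
      refine Subtype.ext ?_
      exact (toDerivative_eq_zero_iff e).2 ⟨y, h1⟩
  · rintro X ⟨z, hz⟩
    obtain ⟨z, rfl⟩ := toDerivative_surjective e V X z
    obtain ⟨y, hy⟩ := (toDerivative_eq_zero_iff e).1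
      ((derivativeMap_apply e K.proj z).symm.trans hz)
    obtain ⟨y, rfl⟩ := K.proj_surjective X y
    rw [← app_translate] at hy
    have hm := (K.proj_eq_iff _ _).1 hy.symm
    refine ⟨⟨z - translate e V X y, hm⟩, Subtype.ext ?_⟩
    change toDerivative e V X (z - translate e V X y) = toDerivative e V X z
    rw [map_sub, toDerivative_translate, sub_zero]

lemma comap_proj_preTranslate_iterate {V W : CMod k C} (p : V ⟶ W) (N : CSubmodule W) (j : ℕ) :
    CSubmodule.comap p ((CSubmodule.preTranslate e)^[j] N) =
      (CSubmodule.preTranslate e)^[j] (CSubmodule.comap p N) := by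
  induction j generalizing N with
  | zero => rfl
  | succ j ih =>
    rw [Function.iterate_succ_apply, ih, Function.iterate_succ_apply]
    congr 1
    ext X x
    rw [CSubmodule.mem_comap, CSubmodule.mem_preTranslate, CSubmodule.mem_preTranslate,
      CSubmodule.mem_comap, app_translate]

/-- The inductive step: if the derivatives of all `C`-modules generated in degrees `< n + 1` have
finite regularity, then so do these `C`-modules. -/
theorem exists_regLT_of_iterate_le [IsNoetherianRing k]
    (hreg : ∀ s : ℕ, RegLT (s + 1) (ι.shift.obj (M k C s)))
    (he : ∀ (s : ℕ) (X : C), Function.Injective (translate e (M k C s) X)) {n : ℕ}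
    (ih : ∀ V : CMod k C, PointwiseFinite V → GeneratedLT (n + 1) V →
      ∃ a, RegLT a (derivative e V)) (N : ℕ)
    {V : CMod k C} (hV : PointwiseFinite V) (hn : GeneratedLT (n + 1) V)
    (hN : (CSubmodule.preTranslate e)^[N + 1] (⊥ : CSubmodule V) ≤
      (CSubmodule.preTranslate e)^[N] ⊥) :
    ∃ a, RegLT a V ∧ RegLT a (CSubmodule.ker (toShift e V)).toCMod := by
  induction N generalizing V with
  | zero =>
    -- The chain is already stationary at 0, so V embeds in SV.
    have hinj (X : C) (x : V.obj.obj X) (hx : translate e V X x = 0) : x = 0 := hN X hx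
    obtain ⟨a, ha⟩ := ih V hV hn
    refine ⟨a + 1, regLT_of_derivative hreg he hV
      (fun X => (injective_iff_map_eq_zero _).2 (hinj X)) ha, regLT_of_subsingleton (fun X => ?_) _⟩
    exact ⟨fun x y => Subtype.ext ((hinj X x.1 x.2).trans (hinj X y.1 y.2).symm)⟩
  | succ N ihN =>
    let K := CSubmodule.ker (toShift e V)
    -- The zero submodule of F pulls back to K, the first step of the chain of V, so the chain of F
    -- is that of V with its index lowered by one.
    have hKp : CSubmodule.comap K.proj ⊥ = CSubmodule.preTranslate e ⊥ := by
      ext X x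
      rw [CSubmodule.mem_comap, CSubmodule.mem_bot, K.proj_eq_zero_iff]
      rfl
    have hF := hV.of_surjective K.proj K.proj_surjective
    have hFn := hn.of_surjective K.proj K.proj_surjective
    obtain ⟨a, haF, haK⟩ := ihN hF hFn (by
      intro X x hx
      obtain ⟨x, rfl⟩ := K.proj_surjective X x
      rw [← CSubmodule.mem_comap, comap_proj_preTranslate_iterate, hKp,
        ← Function.iterate_succ_apply] at hx ⊢
      exact hN X hx)
    obtain ⟨b, hb⟩ := ih V hV hn
    obtain ⟨c, hc⟩ := ih K.quot hF hFn
    have hJ := (IsSES.of_ker (derivativeMap e K.proj) fun X y => by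
      obtain ⟨y, rfl⟩ := toDerivative_surjective e _ X y
      obtain ⟨x, rfl⟩ := K.proj_surjective _ y
      exact ⟨toDerivative e V X x, rfl⟩).regLT_left (a := max b c)
        (hb.mono (by lia)) (hc.mono (by lia))
    obtain ⟨f, g, hfg⟩ := exists_lift_ker_derivativeMap (e := e) V
    -- The bound on ker(F → SF), carried along in the induction, is used here.
    have hSK := hfg.regLT_middle (a := max a (max b c + 1)) (haK.mono (by lia)) (hJ.mono (by lia))
    have hK := regLT_of_shift hreg (hV.toCMod K) hSK
    exact ⟨_, (IsSES.of_quot K).regLT_middle hK (haF.mono (by lia)), hK⟩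

/-- For a generic shift functor with `reg (S M(s)) ≤ s`, finitely generated modules have finite
regularity. -/
theorem exists_regLT [IsNoetherianRing k]
    (hreg : ∀ s : ℕ, RegLT (s + 1) (ι.shift.obj (M k C s)))
    (he : ∀ (s : ℕ) (X : C), Function.Injective (translate e (M k C s) X))
    (hgen : ∀ s, GeneratedLT s (derivative e (M k C s))) (n : ℕ) {V : CMod k C}
    (hV : PointwiseFinite V) (hn : GeneratedLT n V) : ∃ a, RegLT a V := by
  induction n generalizing V with
  | zero => exact ⟨0, regLT_of_subsingleton (generatedLT_zero_iff.1 hn) 0⟩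
  | succ n ih =>
    have := hV.wellFoundedGT hgen hn
    -- The j-th iterate applied to ⊥ consists of the elements killed by j successive translations.
    obtain ⟨N, hN⟩ := WellFoundedGT.monotone_chain_condition
      (⟨fun j => (CSubmodule.preTranslate e)^[j] (⊥ : CSubmodule V),
        monotone_nat_of_le_succ fun j => by
          rw [Function.iterate_succ_apply']
          exact CSubmodule.le_preTranslate e _⟩ : ℕ →o CSubmodule V)
    obtain ⟨a, ha, _⟩ := exists_regLT_of_iterate_le hreg he
      (fun V hV hn => ih hV.derivative (generatedLT_derivative hgen hn)) N hV hn
      (hN (N + 1) N.le_succ).ge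
    exact ⟨a, ha⟩

end SelfEmbedding

end Main

end DirectedLinearCategory

theorem corollary1p3 {k : Type u} [CommRing k] [IsNoetherianRing k]
    {C : Type w} [Category.{v} C] [Preadditive C] [Linear k C] [DirectedLinearCategory k C]
    (S : DirectedLinearCategory.SelfEmbedding k C) (hS : S.IsGeneric)
    (hreg : ∀ s : ℕ,
      DirectedLinearCategory.reg (S.shift.obj (DirectedLinearCategory.M k C s)) ≤ (s : EReal))
    (V : DirectedLinearCategory.CMod k C) (hV : DirectedLinearCategory.IsFinitelyGenerated V) :
    DirectedLinearCategory.reg V < ⊤ := by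
  obtain ⟨e, he, hgen⟩ := hS.exists_natTrans
  obtain ⟨l, p, hp⟩ := hV.exists_freeOn
  -- `l.sum + 1` is a crude strict upper bound for the degrees of the chosen generators.
  obtain ⟨a, ha⟩ := DirectedLinearCategory.SelfEmbedding.exists_regLT
    (fun s => DirectedLinearCategory.regLT_of_reg_le (hreg s)) he hgen (l.sum + 1)
    ((DirectedLinearCategory.pointwiseFinite_freeOn l).of_surjective p hp)
    ((DirectedLinearCategory.generatedLT_freeOn fun s hs =>
      Nat.lt_succ_of_le (List.le_sum_of_mem hs)).of_surjective p hp)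
  exact ha.reg_lt_top
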